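/- **Setting.** Let $\mathbb T$ be one of $\{0,\dots,T\}$ with $T\in\mathbb N_0$, $\mathbb N_0$, or $\mathbb N_0\cup\{\infty\}$ (with $T=\infty$ in the last two cases), and $\mathbb T_t:=\{s\in\mathbb T: s\ge t\}$. Let $(\Omega,\mathcal F,(\mathcal F_t)_{t\in\mathbb T\cap\mathbb N_0},P)$ be a filtered probability space with $\mathcal F_0=\{\emptyset,\Omega\}$, and $\mathcal F_\infty:=\sigma(\bigcup_t\mathcal F_t)$ if $T=\infty$. Write $L^\infty_t=L^\infty(\Omega,\mathcal F_t,P)$. Let $\mathcal R^\infty$ be the space of adapted processes $X=(X_t)_{t\in\mathbb T}$ with $\sup_{t\in\mathbb T}|X_t|$ $P$-essentially bounded. Put $\pi_{t,s}(X)_r:=1_{\{t\le r\}}X_{r\wedge s}$, $\mathcal R^\infty_{t,s}:=\pi_{t,s}(\mathcal R^\infty)$ and $\mathcal R^\infty_t:=\pi_{t,T}(\mathcal R^\infty)$. Unless stated otherwise, relations between random variables hold $P$-a.s. **Risk measures.** For $t\in\mathbb T\cap\mathbb N_0$ a conditional convex risk measure for processes is a map $\rho_t:\mathcal R^\infty_t\to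 L^\infty_t$ such that, for $X,Y\in\mathcal R^\infty_t$: $\rho_t(X+m1_{\mathbb T_t})=\rho_t(X)-m$ for $m\in L^\infty_t$; $\rho_t(X)\ge\rho_t(Y)$ if $X\le Y$; $\rho_t(\lambda X+(1-\lambda)Y)\le\lambda\rho_t(X)+(1-\lambda)\rho_t(Y)$ for $\lambda\in L^\infty_t$ with $0\le\lambda\le1$; and $\rho_t(0)=0$. For $X\in\mathcal R^\infty$ put $\rho_t(X):=\rho_t(\pi_{t,T}(X))$. It is continuous from above if $\rho_t(X^n)\nearrow\rho_t(X)$ whenever $X^n,X\in\mathcal R^\infty$ and $X^n_s\searrow X_s$ for all $s\in\mathbb T_t$. A family $(\rho_t)_{t\in\mathbb T\cap\mathbb N_0}$ of such risk measures is time consistent if for all $t<T$ and all $X,Y\in\mathcal R^\infty$, $X_t=Y_t$ and $\rho_{t+1}(X)\le\rho_{t+1}(Y)$ imply $\rho_t(X)\le\rho_t(Y)$. **Models.** Let $Q$ be a probability measure on $(\Omega,\mathcal F)$ with $Q\ll P$ on $\mathcal F_t$ for every $t\in\mathbb T\cap\mathbb N_0$. For $T=\infty$ let $M_t=\frac{dQ}{dP}\big|_{\mathcal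 F_t}$ and $M_\infty=\lim_{t\to\infty}M_t$ (which exists $P$- and $Q$-a.s.). Let $\mathcal D(Q)$ be the set of predictable, nonnegative, non-increasing processes $D=(D_t)_{t\in\mathbb T}$ with $D_0=1$ (predictable: $D_0$ is $\mathcal F_0$-measurable, $D_{t+1}$ is $\mathcal F_t$-measurable, $D_\infty$ is $\mathcal F_\infty$-measurable) such that $Q$-a.s. $\lim_{t\to\infty}D_t=0$ if $\mathbb T=\mathbb N_0$, and such that $Q$-a.s. $D_\infty=\lim_{t\to\infty}D_t$, with $D_\infty=0$ on $\{M_\infty=\infty\}$, if $\mathbb T=\mathbb N_0\cup\{\infty\}$. For $D\in\mathcal D(Q)$ put $\gamma_t:=D_t-D_{t+1}$ for $t\in\mathbb T\cap\mathbb N_0$ (with $D_{T+1}:=0$ if $T<\infty$) and $\gamma_\infty:=D_\infty$ if $\infty\in\mathbb T$. The pair $(Q,D)$ is denoted $Q\otimes D$; it represents the probability measure $X\mapsto E_Q[\sum_{t\in\mathbb T}\gamma_tX_t]$ on the optional $\sigma$-field of $\Omega\times\mathbb T$. **Penalties.** Let $\mathcal A_t:=\{X\in\mathcal R^\infty_t:\rho_t(X)\le0\}$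 for $t\in\mathbb T\cap\mathbb N_0$, and $\mathcal A_{t,t+1}:=\{X\in\mathcal R^\infty_{t,t+1}:\rho_t(X)\le0\}$ for $t\in\mathbb T\cap\mathbb N_0$ with $t<T$. On $\{D_t>0\}$ put $$\alpha_t(Q\otimes D):=Q\text{-}\operatorname*{ess\,sup}_{X\in\mathcal A_t}E_Q\Big[-\sum_{s\in\mathbb T_t}\frac{\gamma_s}{D_t}X_s\,\Big|\,\mathcal F_t\Big],$$ $$\alpha_{t,t+1}(Q\otimes D):=\frac1{D_t}\,Q\text{-}\operatorname*{ess\,sup}_{X\in\mathcal A_{t,t+1}}E_Q\big[-\gamma_tX_t-D_{t+1}X_{t+1}\,\big|\,\mathcal F_t\big],$$ and let both be $+\infty$ on $\{D_t=0\}$, with the convention $0\cdot\infty:=0$. **Corollary 4.4.** Let $(\rho_t)_{t\in\mathbb T\cap\mathbb N_0}$ be a time consistent family of conditional convex risk measures for processes, each $\rho_t$ continuous from above. Let $Q$ and $D\in\mathcal D(Q)$ be as above, with $\alpha_0(Q\otimes D)<\infty$ $Q$-a.s. 1. The process $(D_t\alpha_t(Q\otimes D))_{t\in\mathbb T\cap\mathbb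 N_0}$ is a nonnegative $Q$-supermartingale. Its Doob decomposition is given by the process $$A_t^{Q,D}:=\sum_{k=0}^{t-1}D_k\alpha_{k,k+1}(Q\otimes D),\qquad t\in\mathbb T\cap\mathbb N_0,$$ which is predictable, $Q$-a.s. finite and non-decreasing, and starts at $0$: the process $M^{Q,D}_t:=D_t\alpha_t(Q\otimes D)+A^{Q,D}_t$, $t\in\mathbb T\cap\mathbb N_0$, is a $Q$-martingale. 2. For every $X\in\mathcal R^\infty$ the process $$W^{Q,D}_t(X):=D_t\rho_t(X-X_t1_{\mathbb T_t})+\sum_{s=0}^tD_s(-\Delta X_s)+D_t\alpha_t(Q\otimes D),\qquad t\in\mathbb T\cap\mathbb N_0,$$ is a $Q$-supermartingale, where $\Delta X_s:=X_s-X_{s-1}$ and $X_{-1}:=0$. (In particular all these processes are $Q$-a.s. finite and $Q$-integrable.) -/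

import Mathlib

open MeasureTheory Filter Topology

/-! ### Essential suprema of families of random variables -/

/-- `Z` is the `Q`-essential supremum of the family `S` of real random variables, relative to the
sub-`σ`-field `m`: it is `m`-measurable, dominates every member of `S` almost surely, and is
almost surely the least function doing so. -/
def IsFamilyEssSup {Ω : Type*} {mΩ : MeasurableSpace Ω} (Q : Measure Ω) (m : MeasurableSpace Ω)
    (S : Set (Ω → ℝ)) (Z : Ω → EReal) : Prop :=
  Measurable[m] Z ∧ (∀ f ∈ S, ∀ᵐ ω ∂Q, (f ω : EReal) ≤ Z ω) ∧
    ∀ Z' : Ω → EReal, (∀ f ∈ S, ∀ᵐ ω ∂Q, (f ω : EReal) ≤ Z' ω) → ∀ᵐ ω ∂Q, Z ω ≤ Z' ω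

theorem exists_isFamilyEssSup {Ω : Type*} {mΩ : MeasurableSpace Ω} (Q : Measure Ω)
    [IsFiniteMeasure Q] {m : MeasurableSpace Ω} (hm : m ≤ mΩ) {S : Set (Ω → ℝ)}
    (hS : ∀ f ∈ S, Measurable[m] f) : ∃ Z, IsFamilyEssSup Q m S Z := by
  classical
  rcases S.eq_empty_or_nonempty with rfl | hne
  · exact ⟨fun _ => ⊥, measurable_const, by simp, fun Z' _ => by simp⟩
  have : Nonempty S := hne.to_subtype
  let g : S → Ω → ENNReal := fun f ω => ENNReal.ofReal (Real.arctan (f.1 ω) + 2)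
  have hg : ∀ f, Measurable[mΩ] (g f) := fun f =>
    ENNReal.measurable_ofReal.comp
      ((Real.continuous_arctan.measurable.comp ((hS f.1 f.2).mono hm le_rfl)).add_const 2)
  have hpi : ∀ x : ℝ, 0 < Real.arctan x + 2 := fun x => by
    have h1 := Real.neg_pi_div_two_lt_arctan x
    have h2 := Real.pi_lt_four
    linarith
  have hg4 : ∀ f ω, g f ω ≤ 4 := fun f ω => by
    have h1 := Real.arctan_lt_pi_div_two (f.1 ω)
    have h2 := Real.pi_lt_four
    have h3 : (4 : ENNReal) = ENNReal.ofReal 4 := by norm_num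
    rw [h3]
    exact ENNReal.ofReal_le_ofReal (by linarith)
  let I : (ℕ → S) → ENNReal := fun u => ∫⁻ ω, ⨆ n, g (u n) ω ∂Q
  obtain ⟨v, -, hv, hvm⟩ := exists_seq_tendsto_sSup (S := Set.range I)
    (Set.range_nonempty I) (OrderTop.bddAbove _)
  choose U hU using hvm
  let u : ℕ → S := fun n => U n.unpair.1 n.unpair.2
  have hmono : ∀ k, I (U k) ≤ I u := fun k => by
    refine lintegral_mono fun ω => iSup_le fun n => ?_
    refine le_iSup_of_le (Nat.pair k n) ?_
    simp [u]
  have hmax : ∀ w, I w ≤ I u := fun w => by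
    have h0 : I w ≤ sSup (Set.range I) := le_sSup (Set.mem_range_self w)
    refine h0.trans (le_of_tendsto' hv fun k => ?_)
    rw [← hU k]
    exact hmono k
  refine ⟨fun ω => ⨆ n, ((u n).1 ω : EReal), ?_, ?_, ?_⟩
  · exact Measurable.iSup fun n => measurable_coe_real_ereal.comp (hS _ (u n).2)
  · intro f hf
    let w : ℕ → S := fun n => Nat.casesOn n ⟨f, hf⟩ u
    have hle : (fun ω => ⨆ n, g (u n) ω) ≤ᵐ[Q] fun ω => ⨆ n, g (w n) ω :=
      Eventually.of_forall fun ω => iSup_le fun n => le_iSup_of_le (n + 1) le_rfl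
    have hfin : ∫⁻ ω, ⨆ n, g (u n) ω ∂Q ≠ ⊤ := by
      have h4 : ∫⁻ ω, ⨆ n, g (u n) ω ∂Q ≤ ∫⁻ _, 4 ∂Q :=
        lintegral_mono fun ω => iSup_le fun n => hg4 _ _
      refine ne_top_of_le_ne_top ?_ h4
      rw [lintegral_const]
      exact ENNReal.mul_ne_top (by norm_num) (measure_ne_top _ _)
    have heq := ae_eq_of_ae_le_of_lintegral_le hle hfin
      (@Measurable.aemeasurable _ _ mΩ _ _ Q (Measurable.iSup fun n => hg (w n))) (hmax w)
    filter_upwards [heq] with ω hω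
    by_contra hlt
    obtain ⟨r, hr1, hr2⟩ := EReal.exists_rat_btwn_of_lt (not_le.1 hlt)
    have hbound : (⨆ n, g (u n) ω) ≤ ENNReal.ofReal (Real.arctan (r : ℝ) + 2) := by
      refine iSup_le fun n => ENNReal.ofReal_le_ofReal ?_
      have h1 : ((u n).1 ω : EReal) < ((r : ℝ) : EReal) :=
        (le_iSup (fun n => ((u n).1 ω : EReal)) n).trans_lt hr1
      have h2 := Real.arctan_strictMono.monotone (EReal.coe_lt_coe_iff.1 h1).le
      linarith
    have hf2 : ENNReal.ofReal (Real.arctan (f ω) + 2) ≤ ⨆ n, g (w n) ω :=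
      le_iSup_of_le 0 le_rfl
    rw [← hω] at hf2
    have h3 := (ENNReal.ofReal_le_ofReal_iff (hpi _).le).1 (hf2.trans hbound)
    have h4 := Real.arctan_strictMono (EReal.coe_lt_coe_iff.1 hr2)
    linarith
  · intro Z' hZ'
    have h := ae_all_iff.2 fun n => hZ' _ (u n).2
    filter_upwards [h] with ω hω
    exact iSup_le hω

/-- A version of the `Q`-essential supremum of the family `S`, measurable with respect to `m`. -/
noncomputable def familyEssSup {Ω : Type*} {mΩ : MeasurableSpace Ω} (Q : Measure Ω)
    (m : MeasurableSpace Ω) (S : Set (Ω → ℝ)) : Ω → EReal :=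
  Classical.epsilon (IsFamilyEssSup Q m S)

theorem isFamilyEssSup_familyEssSup {Ω : Type*} {mΩ : MeasurableSpace Ω} (Q : Measure Ω)
    [IsFiniteMeasure Q] {m : MeasurableSpace Ω} (hm : m ≤ mΩ) {S : Set (Ω → ℝ)}
    (hS : ∀ f ∈ S, Measurable[m] f) : IsFamilyEssSup Q m S (familyEssSup Q m S) :=
  Classical.epsilon_spec (exists_isFamilyEssSup Q hm hS)

/-! ### Time sets, processes -/

/-- The three kinds of time sets: `{0, …, T}`, `ℕ`, and `ℕ ∪ {∞}`. -/
inductive Horizon where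
  | finite (T : ℕ)
  | nat
  | natTop

namespace Horizon

/-- The time horizon `T ∈ ℕ ∪ {∞}`. -/
def last : Horizon → ℕ∞
  | finite T => T
  | nat => ⊤
  | natTop => ⊤

/-- The set of time points, as a subset of `ℕ ∪ {∞}`. -/
def times : Horizon → Set ℕ∞
  | finite T => {s | s ≤ (T : ℕ∞)}
  | nat => {s | s ≠ ⊤}
  | natTop => Set.univ

/-- The time points that are `≥ t`. -/
def timesFrom (𝕋 : Horizon) (t : ℕ∞) : Set ℕ∞ := {s | s ∈ 𝕋.times ∧ t ≤ s}

/-- The finite time points. -/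
abbrev FiniteTimes (𝕋 : Horizon) : Type := {t : ℕ // (t : ℕ∞) ∈ 𝕋.times}

end Horizon

/-- A real process; only its values at the time points of the given horizon matter. -/
abbrev RealProcess (Ω : Type*) : Type _ := ℕ∞ → Ω → ℝ

section Processes

variable {Ω : Type*} {mΩ : MeasurableSpace Ω}

/-- The `σ`-field at time `s ∈ ℕ ∪ {∞}`, where `∞` gets the `σ`-field generated by all others. -/
abbrev sigmaAt (ℱ : Filtration ℕ mΩ) (s : ℕ∞) : MeasurableSpace Ω :=
  ⨆ n : ℕ, ⨆ _ : (n : ℕ∞) ≤ s, ℱ n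

/-- The filtration, indexed by the finite time points only. -/
def restrictTimes (ℱ : Filtration ℕ mΩ) (𝕋 : Horizon) : Filtration 𝕋.FiniteTimes mΩ where
  seq t := ℱ t.1
  mono' _ _ h := ℱ.mono h
  le' t := ℱ.le t.1

/-- `L^∞(Ω, m, P)`, in terms of `m`-measurable representatives. -/
def Linfty (P : Measure Ω) (m : MeasurableSpace Ω) : Set (Ω → ℝ) :=
  {f | StronglyMeasurable[m] f ∧ ∃ C : ℝ, ∀ᵐ ω ∂P, |f ω| ≤ C}

/-- `ℛ^∞`: adapted processes with `P`-essentially bounded supremum over all time points. -/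
def Rinfty (P : Measure Ω) (ℱ : Filtration ℕ mΩ) (𝕋 : Horizon) : Set (RealProcess Ω) :=
  {X | (∀ s ∈ 𝕋.times, StronglyMeasurable[sigmaAt ℱ s] (X s)) ∧
    ∃ C : ℝ, ∀ᵐ ω ∂P, ∀ s ∈ 𝕋.times, |X s ω| ≤ C}

/-- The projection `π_{t,s}(X)_r = 1_{t ≤ r} X_{r ∧ s}`. -/
noncomputable def proj (t s : ℕ∞) (X : RealProcess Ω) : RealProcess Ω :=
  fun r ω => if t ≤ r then X (min r s) ω else 0

/-- `ℛ^∞_{t,s} = π_{t,s}(ℛ^∞)`. -/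
def RinftyBetween (P : Measure Ω) (ℱ : Filtration ℕ mΩ) (𝕋 : Horizon) (t s : ℕ∞) :
    Set (RealProcess Ω) :=
  proj t s '' Rinfty P ℱ 𝕋

/-- `ℛ^∞_t = π_{t,T}(ℛ^∞)`. -/
def RinftyFrom (P : Measure Ω) (ℱ : Filtration ℕ mΩ) (𝕋 : Horizon) (t : ℕ∞) :
    Set (RealProcess Ω) :=
  RinftyBetween P ℱ 𝕋 t 𝕋.last

/-- The process `m 1_{𝕋_t}`, for a random variable `m`. -/
noncomputable def stepFrom (t : ℕ∞) (m : Ω → ℝ) : RealProcess Ω := fun r ω => if t ≤ r then m ω else 0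

/-- The increments `X_t - X_{t-1}`, with `X_{-1} = 0`. -/
def increment (X : RealProcess Ω) : ℕ → Ω → ℝ
  | 0 => fun ω => X 0 ω
  | s + 1 => fun ω => X ((s + 1 : ℕ) : ℕ∞) ω - X (s : ℕ∞) ω

/-! ### Risk measures for processes -/

/-- Conditional convex risk measures for processes at time `t`, as maps `ℛ^∞_t → L^∞_t` acting on
representatives. Monotonicity makes the map compatible with almost sure equality; the values of
`ρ` outside `ℛ^∞_t` are never used. -/
structure IsConditionalConvexRisk (P : Measure Ω) (ℱ : Filtration ℕ mΩ) (𝕋 : Horizon) (t : ℕ)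
    (ρ : RealProcess Ω → Ω → ℝ) : Prop where
  mem_Linfty : ∀ X ∈ RinftyFrom P ℱ 𝕋 t, ρ X ∈ Linfty P (ℱ t)
  cash_invariance : ∀ X ∈ RinftyFrom P ℱ 𝕋 t, ∀ m ∈ Linfty P (ℱ t),
    ∀ᵐ ω ∂P, ρ (X + stepFrom t m) ω = ρ X ω - m ω
  monotonicity : ∀ X ∈ RinftyFrom P ℱ 𝕋 t, ∀ Y ∈ RinftyFrom P ℱ 𝕋 t,
    (∀ s ∈ 𝕋.times, ∀ᵐ ω ∂P, X s ω ≤ Y s ω) → ∀ᵐ ω ∂P, ρ Y ω ≤ ρ X ω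
  convexity : ∀ X ∈ RinftyFrom P ℱ 𝕋 t, ∀ Y ∈ RinftyFrom P ℱ 𝕋 t, ∀ l ∈ Linfty P (ℱ t),
    (∀ᵐ ω ∂P, 0 ≤ l ω ∧ l ω ≤ 1) →
      ∀ᵐ ω ∂P, ρ (fun s ω' => l ω' * X s ω' + (1 - l ω') * Y s ω') ω
        ≤ l ω * ρ X ω + (1 - l ω) * ρ Y ω
  normalization : ∀ᵐ ω ∂P, ρ 0 ω = 0

/-- A dynamic convex risk measure: one conditional convex risk measure per finite time point. -/
def IsDynamicConvexRisk (P : Measure Ω) (ℱ : Filtration ℕ mΩ) (𝕋 : Horizon)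
    (ρ : ℕ → RealProcess Ω → Ω → ℝ) : Prop :=
  ∀ t : ℕ, (t : ℕ∞) ∈ 𝕋.times → IsConditionalConvexRisk P ℱ 𝕋 t (ρ t)

/-- The convention `ρ_t(X) := ρ_t(π_{t,T}(X))` for `X ∈ ℛ^∞`. -/
noncomputable def risk (𝕋 : Horizon) (ρ : ℕ → RealProcess Ω → Ω → ℝ) (t : ℕ) (X : RealProcess Ω) : Ω → ℝ :=
  ρ t (proj t 𝕋.last X)

/-- Continuity from above at time `t`. -/
def ContinuousFromAbove (P : Measure Ω) (ℱ : Filtration ℕ mΩ) (𝕋 : Horizon)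
    (ρ : ℕ → RealProcess Ω → Ω → ℝ) (t : ℕ) : Prop :=
  ∀ (Xs : ℕ → RealProcess Ω) (X : RealProcess Ω), (∀ n, Xs n ∈ Rinfty P ℱ 𝕋) →
    X ∈ Rinfty P ℱ 𝕋 →
    (∀ s ∈ 𝕋.timesFrom t, ∀ᵐ ω ∂P, Antitone (fun n => Xs n s ω) ∧
      Tendsto (fun n => Xs n s ω) atTop (𝓝 (X s ω))) →
    ∀ᵐ ω ∂P, Monotone (fun n => risk 𝕋 ρ t (Xs n) ω) ∧
      Tendsto (fun n => risk 𝕋 ρ t (Xs n) ω) atTop (𝓝 (risk 𝕋 ρ t X ω))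

/-- (Strong) time consistency. -/
def TimeConsistent (P : Measure Ω) (ℱ : Filtration ℕ mΩ) (𝕋 : Horizon)
    (ρ : ℕ → RealProcess Ω → Ω → ℝ) : Prop :=
  ∀ t : ℕ, (t : ℕ∞) < 𝕋.last → ∀ X ∈ Rinfty P ℱ 𝕋, ∀ Y ∈ Rinfty P ℱ 𝕋,
    (∀ᵐ ω ∂P, X t ω = Y t ω) →
    (∀ᵐ ω ∂P, risk 𝕋 ρ (t + 1) X ω ≤ risk 𝕋 ρ (t + 1) Y ω) →
    ∀ᵐ ω ∂P, risk 𝕋 ρ t X ω ≤ risk 𝕋 ρ t Y ω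

/-! ### Models and discounting processes -/

/-- `Q ≪ P` on `ℱ_t` for every finite time point `t`. -/
def LocallyAbsolutelyContinuous (P Q : Measure Ω) (ℱ : Filtration ℕ mΩ) (𝕋 : Horizon) : Prop :=
  ∀ t : ℕ, (t : ℕ∞) ∈ 𝕋.times → Q.trim (ℱ.le t) ≪ P.trim (ℱ.le t)

/-- The density `M_n` of `Q` with respect to `P` on `ℱ_n`. -/
noncomputable def densityProcess (P Q : Measure Ω) (ℱ : Filtration ℕ mΩ) (n : ℕ) (ω : Ω) :
    ENNReal :=
  (Q.trim (ℱ.le n)).rnDeriv (P.trim (ℱ.le n)) ω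

/-- `M_∞ = lim M_n`. The limit exists almost surely under `P` and under `Q`; the upper limit is a
version of it that is defined everywhere. -/
noncomputable def densityLimit (P Q : Measure Ω) (ℱ : Filtration ℕ mΩ) (ω : Ω) : ENNReal :=
  limsup (fun n : ℕ => densityProcess P Q ℱ n ω) atTop

/-- The class `𝒟(Q)` of predictable discounting processes. -/
structure IsDiscounting (P Q : Measure Ω) (ℱ : Filtration ℕ mΩ) (𝕋 : Horizon)
    (D : RealProcess Ω) : Prop where
  measurable_zero : StronglyMeasurable[ℱ 0] (D 0)
  measurable_succ : ∀ t : ℕ, ((t + 1 : ℕ) : ℕ∞) ∈ 𝕋.times →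
    StronglyMeasurable[ℱ t] (D ((t + 1 : ℕ) : ℕ∞))
  measurable_top : ⊤ ∈ 𝕋.times → StronglyMeasurable[sigmaAt ℱ ⊤] (D ⊤)
  start : ∀ᵐ ω ∂Q, D 0 ω = 1
  nonneg : ∀ t ∈ 𝕋.times, ∀ᵐ ω ∂Q, 0 ≤ D t ω
  antitone : ∀ t : ℕ, ((t + 1 : ℕ) : ℕ∞) ∈ 𝕋.times →
    ∀ᵐ ω ∂Q, D ((t + 1 : ℕ) : ℕ∞) ω ≤ D (t : ℕ∞) ω
  /-- In the case `𝕋 = ℕ`, the limit at infinity vanishes. -/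
  limit_nat : 𝕋 = Horizon.nat →
    ∀ᵐ ω ∂Q, Tendsto (fun n : ℕ => D (n : ℕ∞) ω) atTop (𝓝 0)
  /-- In the case `𝕋 = ℕ ∪ {∞}`, the value at infinity is the limit. -/
  limit_natTop : 𝕋 = Horizon.natTop →
    ∀ᵐ ω ∂Q, Tendsto (fun n : ℕ => D (n : ℕ∞) ω) atTop (𝓝 (D ⊤ ω))
  /-- In the case `𝕋 = ℕ ∪ {∞}`, the value at infinity vanishes on `{M_∞ = ∞}`. -/
  singular_natTop : 𝕋 = Horizon.natTop →
    ∀ᵐ ω ∂Q, densityLimit P Q ℱ ω = ⊤ → D ⊤ ω = 0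

open Classical in
/-- The optional random measure of `D`: `γ_t = D_t - D_{t+1}` at finite times, where
`D_{T+1} = 0` if `T` is finite, and `γ_∞ = D_∞`. -/
noncomputable def optionalMeasure (𝕋 : Horizon) (D : RealProcess Ω) : RealProcess Ω :=
  fun t ω => if t = ⊤ then D ⊤ ω else D t ω - (if t + 1 ∈ 𝕋.times then D (t + 1) ω else 0)

/-! ### Penalty functions -/

/-- The acceptance set `𝒜_t`. -/
def acceptanceSet (P : Measure Ω) (ℱ : Filtration ℕ mΩ) (𝕋 : Horizon)
    (ρ : ℕ → RealProcess Ω → Ω → ℝ) (t : ℕ) : Set (RealProcess Ω) :=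
  {X | X ∈ RinftyFrom P ℱ 𝕋 t ∧ ∀ᵐ ω ∂P, ρ t X ω ≤ 0}

/-- The one-step acceptance set `𝒜_{t,t+1}`. Its members are stopped at `t + 1`, so that
`π_{t,T}` leaves them unchanged. -/
def acceptanceSetStep (P : Measure Ω) (ℱ : Filtration ℕ mΩ) (𝕋 : Horizon)
    (ρ : ℕ → RealProcess Ω → Ω → ℝ) (t : ℕ) : Set (RealProcess Ω) :=
  {X | X ∈ RinftyBetween P ℱ 𝕋 t (t + 1 : ℕ) ∧ ∀ᵐ ω ∂P, ρ t X ω ≤ 0}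

open Classical in
/-- The minimal penalty `α_t(Q ⊗ D)`: the `Q`-essential supremum over `X ∈ 𝒜_t` of
`E_Q[-∑_{s ∈ 𝕋_t} (γ_s / D_t) X_s | ℱ_t]` on `{D_t > 0}`, and `∞` on `{D_t = 0}`. -/
noncomputable def penalty (P : Measure Ω) (ℱ : Filtration ℕ mΩ) (𝕋 : Horizon)
    (ρ : ℕ → RealProcess Ω → Ω → ℝ) (Q : Measure Ω) (D : RealProcess Ω) (t : ℕ) (ω : Ω) : EReal :=
  if D t ω = 0 then ⊤
  else familyEssSup Q (ℱ t)
    {f | ∃ X ∈ acceptanceSet P ℱ 𝕋 ρ t,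
      f = Q[fun ω' => -∑' s : 𝕋.timesFrom t, optionalMeasure 𝕋 D s ω' / D t ω' * X s ω' | ℱ t]} ω

open Classical in
/-- The one-step minimal penalty `α_{t,t+1}(Q ⊗ D)`: on `{D_t > 0}` it is `1 / D_t` times the
`Q`-essential supremum over `X ∈ 𝒜_{t,t+1}` of `E_Q[-γ_t X_t - D_{t+1} X_{t+1} | ℱ_t]`, and it is
`∞` on `{D_t = 0}`. -/
noncomputable def penaltyStep (P : Measure Ω) (ℱ : Filtration ℕ mΩ) (𝕋 : Horizon)
    (ρ : ℕ → RealProcess Ω → Ω → ℝ) (Q : Measure Ω) (D : RealProcess Ω) (t : ℕ) (ω : Ω) : EReal :=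
  if D t ω = 0 then ⊤
  else (((D t ω)⁻¹ : ℝ) : EReal) * familyEssSup Q (ℱ t)
    {f | ∃ X ∈ acceptanceSetStep P ℱ 𝕋 ρ t,
      f = Q[fun ω' => -(optionalMeasure 𝕋 D t ω' * X t ω')
        - D ((t + 1 : ℕ) : ℕ∞) ω' * X ((t + 1 : ℕ) : ℕ∞) ω' | ℱ t]} ω

/-- The discounted penalty `D_t α_t(Q ⊗ D)`, with `0 · ∞ = 0`. -/
noncomputable def discPenalty (P : Measure Ω) (ℱ : Filtration ℕ mΩ) (𝕋 : Horizon)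
    (ρ : ℕ → RealProcess Ω → Ω → ℝ) (Q : Measure Ω) (D : RealProcess Ω) (t : ℕ) (ω : Ω) : EReal :=
  (D t ω : EReal) * penalty P ℱ 𝕋 ρ Q D t ω

/-- The discounted one-step penalty `D_t α_{t,t+1}(Q ⊗ D)`, with `0 · ∞ = 0`. -/
noncomputable def discPenaltyStep (P : Measure Ω) (ℱ : Filtration ℕ mΩ) (𝕋 : Horizon)
    (ρ : ℕ → RealProcess Ω → Ω → ℝ) (Q : Measure Ω) (D : RealProcess Ω) (t : ℕ) (ω : Ω) : EReal :=
  (D t ω : EReal) * penaltyStep P ℱ 𝕋 ρ Q D t ω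

/-- The process `A_t = ∑_{k < t} D_k α_{k,k+1}(Q ⊗ D)`. -/
noncomputable def compensator (P : Measure Ω) (ℱ : Filtration ℕ mΩ) (𝕋 : Horizon)
    (ρ : ℕ → RealProcess Ω → Ω → ℝ) (Q : Measure Ω) (D : RealProcess Ω) (t : ℕ) (ω : Ω) : EReal :=
  ∑ k ∈ Finset.range t, discPenaltyStep P ℱ 𝕋 ρ Q D k ω

/-- The process `W_t(X) = D_t ρ_t(X - X_t 1_{𝕋_t}) + ∑_{s ≤ t} D_s (-ΔX_s) + D_t α_t(Q ⊗ D)`. -/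
noncomputable def riskProcess (P : Measure Ω) (ℱ : Filtration ℕ mΩ) (𝕋 : Horizon)
    (ρ : ℕ → RealProcess Ω → Ω → ℝ) (Q : Measure Ω) (D : RealProcess Ω) (X : RealProcess Ω)
    (t : ℕ) (ω : Ω) : EReal :=
  ((D t ω * risk 𝕋 ρ t (X - stepFrom t (X t)) ω
    + ∑ s ∈ Finset.range (t + 1), D s ω * -(increment X s ω) : ℝ) : EReal)
    + discPenalty P ℱ 𝕋 ρ Q D t ω

end Processes

/-! ### Extended real (super)martingales -/

/-- An extended real process is a `Q`-supermartingale if it is almost surely finite and its real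
version is a supermartingale. -/
def IsSupermartingaleEReal {Ω ι : Type*} [Preorder ι] {mΩ : MeasurableSpace Ω} (Y : ι → Ω → EReal)
    (𝒢 : Filtration ι mΩ) (Q : Measure Ω) : Prop :=
  (∀ t, ∀ᵐ ω ∂Q, Y t ω ≠ ⊤ ∧ Y t ω ≠ ⊥) ∧ Supermartingale (fun t ω => (Y t ω).toReal) 𝒢 Q

/-- An extended real process is a `Q`-martingale if it is almost surely finite and its real
version is a martingale. -/
def IsMartingaleEReal {Ω ι : Type*} [Preorder ι] {mΩ : MeasurableSpace Ω} (Y : ι → Ω → EReal)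
    (𝒢 : Filtration ι mΩ) (Q : Measure Ω) : Prop :=
  (∀ t, ∀ᵐ ω ∂Q, Y t ω ≠ ⊤ ∧ Y t ω ≠ ⊥) ∧ Martingale (fun t ω => (Y t ω).toReal) 𝒢 Q

/-! The engine is the one-step identity `D_t α_t = D_t α_{t,t+1} + E_Q[D_{t+1} α_{t+1} | ℱ_t]`.

Time consistency splits acceptance sets: `𝒜_t = 𝒜_{t,t+1} + 𝒜_{t+1}`. Given an acceptable `X`,
freeze it at time `t + 1` at the cash value `-ρ_{t+1}(X)`. The frozen position is acceptable at `t`,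
and the remainder `π_{t+1,T}(X) + ρ_{t+1}(X) 1_{𝕋_{t+1}}` has risk zero at `t + 1`. This is
`exists_add_of_mem_acceptanceSet`, with converse `add_mem_acceptanceSet`.

A frozen position receives the whole remaining mass `D_{t+1}` at its value at `t + 1`. Expected
losses therefore split like the positions, with the later part conditioned on `ℱ_{t+1}` and then on
`ℱ_t` (`condExp_pairing_add`). The essential supremum passes through `E_Q[· | ℱ_t]` because the
losses at `t + 1` are upward directed (`directed_lossSet`); `IsFamilyEssSup.toReal_eq_sub_condExp`
does this abstractly and `discPenalty_step` specialises it. Since `ℱ_0` is trivial, `α_0 < ∞` makes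
the initial value integrable, and the identity propagates finiteness and integrability forward.
Summing the nonnegative drifts `D_t α_{t,t+1}` gives the Doob decomposition.

For the risk process, cash invariance rewrites `ρ_t(X - X_t 1_{𝕋_t})` as `ρ_t(X) + X_t`. The
increment of its part without penalty is then exactly minus the payment of one acceptable one-step
position (`riskPart_succ`). Its conditional expectation is at most `D_t α_{t,t+1}`, which is what
the penalty term loses on average.

Under `Q`, payments at infinity need care, since `Q` may be singular to `P` there. By
`ae_densityLimit_eq_top` the singular part lives on `{M_∞ = ∞}`, where `D_∞ = 0`. -/

/-! ### Essential suprema and conditional expectations of directed families. -/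

section EssSup

variable {Ω : Type*} {mΩ : MeasurableSpace Ω} {Q : Measure Ω}

/-- A nonempty family has a countable subfamily whose supremum dominates the family a.s. -/
theorem exists_seq_forall_ae_le_iSup [IsFiniteMeasure Q] {S : Set (Ω → ℝ)}
    (hS : ∀ f ∈ S, Measurable f) (hne : S.Nonempty) :
    ∃ u : ℕ → Ω → ℝ, (∀ n, u n ∈ S) ∧
      ∀ f ∈ S, ∀ᵐ ω ∂Q, (f ω : EReal) ≤ ⨆ n, (u n ω : EReal) := by
  classical
  have : Nonempty S := hne.to_subtype
  -- A bounded, strictly increasing rescaling: `2 > π / 2` keeps it positive and `4` bounds it, so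
  -- suprema can be compared through finite integrals.
  let g : S → Ω → ENNReal := fun f ω => ENNReal.ofReal (Real.arctan (f.1 ω) + 2)
  have hg : ∀ f, Measurable (g f) := fun f =>
    ENNReal.measurable_ofReal.comp
      ((Real.continuous_arctan.measurable.comp (hS f.1 f.2)).add_const 2)
  have hpi : ∀ x : ℝ, 0 < Real.arctan x + 2 := fun x => by
    have h1 := Real.neg_pi_div_two_lt_arctan x
    have h2 := Real.pi_lt_four
    linarith
  have hg4 : ∀ f ω, g f ω ≤ 4 := fun f ω => by
    have h1 := Real.arctan_lt_pi_div_two (f.1 ω)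
    have h2 := Real.pi_lt_four
    have h3 : (4 : ENNReal) = ENNReal.ofReal 4 := by norm_num
    rw [h3]
    exact ENNReal.ofReal_le_ofReal (by linarith)
  let I : (ℕ → S) → ENNReal := fun u => ∫⁻ ω, ⨆ n, g (u n) ω ∂Q
  obtain ⟨v, -, hv, hvm⟩ := exists_seq_tendsto_sSup (S := Set.range I)
    (Set.range_nonempty I) (OrderTop.bddAbove _)
  choose U hU using hvm
  -- Merging all sequences of a maximising sequence of sequences gives one sequence that attains the
  -- supremum of `I`.
  let u : ℕ → S := fun n => U n.unpair.1 n.unpair.2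
  have hmono : ∀ k, I (U k) ≤ I u := fun k => by
    refine lintegral_mono fun ω => iSup_le fun n => ?_
    refine le_iSup_of_le (Nat.pair k n) ?_
    simp [u]
  have hmax : ∀ w, I w ≤ I u := fun w => by
    have h0 : I w ≤ sSup (Set.range I) := le_sSup (Set.mem_range_self w)
    refine h0.trans (le_of_tendsto' hv fun k => ?_)
    rw [← hU k]
    exact hmono k
  refine ⟨fun n => (u n).1, fun n => (u n).2, fun f hf => ?_⟩
  -- Putting `f` in front cannot increase the integral, by maximality of `u`; hence it changes the
  -- supremum only on a null set.
  let w : ℕ → S := fun n => Nat.casesOn n ⟨f, hf⟩ u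
  have hle : (fun ω => ⨆ n, g (u n) ω) ≤ᵐ[Q] fun ω => ⨆ n, g (w n) ω :=
    Eventually.of_forall fun ω => iSup_le fun n => le_iSup_of_le (n + 1) le_rfl
  have hfin : ∫⁻ ω, ⨆ n, g (u n) ω ∂Q ≠ ⊤ := by
    have h4 : ∫⁻ ω, ⨆ n, g (u n) ω ∂Q ≤ ∫⁻ _, 4 ∂Q :=
      lintegral_mono fun ω => iSup_le fun n => hg4 _ _
    refine ne_top_of_le_ne_top ?_ h4
    rw [lintegral_const]
    exact ENNReal.mul_ne_top (by norm_num) (measure_ne_top _ _)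
  have heq := ae_eq_of_ae_le_of_lintegral_le hle hfin
    (Measurable.iSup fun n => hg (w n)).aemeasurable (hmax w)
  filter_upwards [heq] with ω hω
  by_contra hlt
  obtain ⟨r, hr1, hr2⟩ := EReal.exists_rat_btwn_of_lt (not_le.1 hlt)
  have hbound : (⨆ n, g (u n) ω) ≤ ENNReal.ofReal (Real.arctan (r : ℝ) + 2) := by
    refine iSup_le fun n => ENNReal.ofReal_le_ofReal ?_
    have h1 : ((u n).1 ω : EReal) < ((r : ℝ) : EReal) :=
      (le_iSup (fun n => ((u n).1 ω : EReal)) n).trans_lt hr1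
    have h2 := Real.arctan_strictMono.monotone (EReal.coe_lt_coe_iff.1 h1).le
    linarith
  have hf2 : ENNReal.ofReal (Real.arctan (f ω) + 2) ≤ ⨆ n, g (w n) ω :=
    le_iSup_of_le 0 le_rfl
  rw [← hω] at hf2
  have h3 := (ENNReal.ofReal_le_ofReal_iff (hpi _).le).1 (hf2.trans hbound)
  have h4 := Real.arctan_strictMono (EReal.coe_lt_coe_iff.1 hr2)
  linarith

/-- The essential supremum of an upward directed family is the limit of an increasing sequence. -/
theorem IsFamilyEssSup.exists_monotone_seq [IsFiniteMeasure Q] {m : MeasurableSpace Ω}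
    {S : Set (Ω → ℝ)} {Z : Ω → EReal} (hZ : IsFamilyEssSup Q m S Z)
    (hS : ∀ f ∈ S, Measurable[mΩ] f) {f₀ : Ω → ℝ} (hf₀ : f₀ ∈ S)
    (hdir : ∀ f ∈ S, ∀ g ∈ S, ∃ h ∈ S, f ≤ᵐ[Q] h ∧ g ≤ᵐ[Q] h) :
    ∃ w : ℕ → Ω → ℝ, (∀ n, w n ∈ S) ∧
      ∀ᵐ ω ∂Q, f₀ ω ≤ w 0 ω ∧ Monotone (fun n => w n ω) ∧ Z ω = ⨆ n, (w n ω : EReal) := by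
  obtain ⟨u, huS, hu⟩ := exists_seq_forall_ae_le_iSup (Q := Q) hS ⟨f₀, hf₀⟩
  choose! J hJS hJl hJr using hdir
  -- Each term dominates its predecessor and the next `u k`, so the sequence increases to the
  -- supremum of all `u k`.
  let w : ℕ → Ω → ℝ := fun n => Nat.rec f₀ (fun k x => J x (u k)) n
  have hw : ∀ n, w n ∈ S := fun n => by
    induction n with
    | zero => exact hf₀
    | succ k ih => exact hJS _ ih _ (huS k)
  have h1 : ∀ᵐ ω ∂Q, ∀ n, w n ω ≤ w (n + 1) ω :=
    ae_all_iff.2 fun n => hJl _ (hw n) _ (huS n)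
  have h2 : ∀ᵐ ω ∂Q, ∀ n, u n ω ≤ w (n + 1) ω :=
    ae_all_iff.2 fun n => hJr _ (hw n) _ (huS n)
  have h3 : ∀ᵐ ω ∂Q, ∀ n, Real.toEReal (w n ω) ≤ Z ω := by
    rw [ae_all_iff]
    exact fun n => hZ.2.1 _ (hw n)
  have h4 := hZ.2.2 _ hu
  refine ⟨w, hw, ?_⟩
  filter_upwards [h1, h2, h3, h4] with ω h1 h2 h3 h4
  refine ⟨le_rfl, monotone_nat_of_le_succ h1, le_antisymm (h4.trans ?_) (iSup_le h3)⟩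
  exact iSup_le fun n => le_iSup_of_le (n + 1) (EReal.coe_le_coe_iff.2 (h2 n))

/-- If a family `S` is the sum of a family `S₁` and of the conditional expectations of a directed
family `S₂`, then so are the essential suprema. -/
theorem IsFamilyEssSup.toReal_eq_sub_condExp [IsFiniteMeasure Q] {m₁ m₂ : MeasurableSpace Ω}
    (hm₁ : m₁ ≤ mΩ) (hm₂ : m₂ ≤ mΩ) {S S₁ S₂ : Set (Ω → ℝ)} {Z V W : Ω → EReal}
    (hZ : IsFamilyEssSup Q m₁ S Z) (hV : IsFamilyEssSup Q m₁ S₁ V)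
    (hW : IsFamilyEssSup Q m₂ S₂ W) (h₁ : 0 ∈ S₁) (h₂ : 0 ∈ S₂)
    (hS₂ : ∀ f ∈ S₂, Measurable[mΩ] f) (hint₂ : ∀ f ∈ S₂, Integrable f Q)
    (hint₁ : ∀ f ∈ S₁, Integrable f Q)
    (hdir : ∀ f ∈ S₂, ∀ g ∈ S₂, ∃ h ∈ S₂, f ≤ᵐ[Q] h ∧ g ≤ᵐ[Q] h)
    (hsplit : ∀ f ∈ S, ∃ g ∈ S₁, ∃ h ∈ S₂, f =ᵐ[Q] g + Q[h | m₁])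
    (hjoin : ∀ g ∈ S₁, ∀ h ∈ S₂, ∃ f ∈ S, f =ᵐ[Q] g + Q[h | m₁])
    (hfin : ∀ᵐ ω ∂Q, Z ω ≠ ⊤) (hint : Integrable (fun ω => (Z ω).toReal) Q) :
    (∀ᵐ ω ∂Q, V ω ≠ ⊤) ∧ (∀ᵐ ω ∂Q, W ω ≠ ⊤) ∧ Integrable (fun ω => (W ω).toReal) Q ∧
      (fun ω => (V ω).toReal) =ᵐ[Q]
        fun ω => (Z ω).toReal - (Q[fun ω' => (W ω').toReal | m₁]) ω := by
  obtain ⟨w, hwS, hw⟩ := hW.exists_monotone_seq hS₂ h₂ hdir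
  have hle : ∀ g ∈ S₁, ∀ h ∈ S₂, ∀ᵐ ω ∂Q, g ω + (Q[h | m₁]) ω ≤ (Z ω).toReal := by
    intro g hg h hh
    obtain ⟨f, hf, hfe⟩ := hjoin g hg h hh
    filter_upwards [hZ.2.1 f hf, hfe, hfin] with ω h1 h2 h3
    rw [h2] at h1
    exact EReal.coe_le_coe_iff.1 (h1.trans (EReal.le_coe_toReal h3))
  have hV0 : ∀ᵐ ω ∂Q, 0 ≤ V ω := hV.2.1 0 h₁
  -- the expectations along the sequence are bounded
  have hbound : ∀ n, ∫ ω, w n ω ∂Q ≤ ∫ ω, (Z ω).toReal ∂Q := by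
    intro n
    rw [← integral_condExp hm₁]
    refine integral_mono_ae integrable_condExp hint ?_
    filter_upwards [hle 0 h₁ _ (hwS n)] with ω h
    simpa using h
  have hZbot : 0 ≤ ∫ ω, (Z ω).toReal ∂Q := by
    refine le_trans (integral_nonneg_of_ae ?_) (hbound 0)
    filter_upwards [hw] with ω h using h.1
  -- Monotone convergence in `ENNReal` does not presuppose that `W` is finite; finiteness and
  -- integrability of `W` are read off from this bound.
  have hmct : ∫⁻ ω, (W ω).toENNReal ∂Q ≤ ENNReal.ofReal (∫ ω, (Z ω).toReal ∂Q) := by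
    have ht : Tendsto (fun n => ∫⁻ ω, ENNReal.ofReal (w n ω) ∂Q) atTop
        (𝓝 (∫⁻ ω, (W ω).toENNReal ∂Q)) := by
      refine lintegral_tendsto_of_tendsto_of_monotone
        (fun n => (hS₂ _ (hwS n)).ennreal_ofReal.aemeasurable) ?_ ?_
      · filter_upwards [hw] with ω h i j hij using ENNReal.ofReal_le_ofReal (h.2.1 hij)
      · filter_upwards [hw] with ω h
        have h1 : Tendsto (fun n => (w n ω : EReal)) atTop (𝓝 (W ω)) := by
          rw [h.2.2]
          exact tendsto_atTop_iSup fun i j hij => EReal.coe_le_coe_iff.2 (h.2.1 hij)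
        have h2 := (EReal.continuous_toENNReal.tendsto (W ω)).comp h1
        simpa [Function.comp_def] using h2
    refine le_of_tendsto' ht fun n => ?_
    rw [← ofReal_integral_eq_lintegral_ofReal (hint₂ _ (hwS n))]
    · exact ENNReal.ofReal_le_ofReal (hbound n)
    · filter_upwards [hw] with ω h using h.1.trans (h.2.1 (Nat.zero_le n))
  have hWm : Measurable[mΩ] fun ω => (W ω).toENNReal :=
    measurable_ereal_toENNReal.comp (fun s hs => hm₂ _ (hW.1 hs))
  have hWfin : ∀ᵐ ω ∂Q, W ω ≠ ⊤ := by
    filter_upwards [ae_lt_top hWm (hmct.trans_lt ENNReal.ofReal_lt_top).ne] with ω h h'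
    simp [h'] at h
  have hW0 : ∀ᵐ ω ∂Q, 0 ≤ W ω := hW.2.1 0 h₂
  have hWint : Integrable (fun ω => (W ω).toReal) Q := by
    refine (integrable_toReal_of_lintegral_ne_top hWm.aemeasurable
      (hmct.trans_lt ENNReal.ofReal_lt_top).ne).congr ?_
    filter_upwards [hW0] with ω h
    exact EReal.toReal_toENNReal h
  have hwt : ∀ᵐ ω ∂Q, Tendsto (fun n => w n ω) atTop (𝓝 (W ω).toReal) := by
    filter_upwards [hw, hWfin, hW0] with ω h hf h0
    have h1 : Tendsto (fun n => (w n ω : EReal)) atTop (𝓝 (W ω)) := by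
      rw [h.2.2]
      exact tendsto_atTop_iSup fun i j hij => EReal.coe_le_coe_iff.2 (h.2.1 hij)
    have h2 := (EReal.tendsto_toReal hf (ne_bot_of_le_ne_bot EReal.zero_ne_bot h0)).comp h1
    simpa [Function.comp_def] using h2
  have hwle : ∀ n, ∀ᵐ ω ∂Q, ‖w n ω‖ ≤ (W ω).toReal := fun n => by
    filter_upwards [hw, hwt] with ω h ht
    rw [Real.norm_of_nonneg (h.1.trans (h.2.1 (Nat.zero_le n)))]
    exact h.2.1.ge_of_tendsto ht n
  -- passing to the limit in the second family
  have hle' : ∀ g ∈ S₁, ∀ᵐ ω ∂Q,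
      g ω + (Q[fun ω' => (W ω').toReal | m₁]) ω ≤ (Z ω).toReal := by
    intro g hg
    -- The positive excess over `Z`. Replacing `W` by `w n` removes it, so its integral is at most
    -- `∫ W - ∫ w n`, which tends to `0`. No conditional monotone convergence is needed.
    let h : Ω → ℝ := fun ω =>
      max (g ω + (Q[fun ω' => (W ω').toReal | m₁]) ω - (Z ω).toReal) 0
    have hhint : Integrable h Q := (((hint₁ g hg).add integrable_condExp).sub hint).pos_part
    have hh0 : 0 ≤ᵐ[Q] h := Eventually.of_forall fun ω => le_max_right _ _
    have hhle : ∀ n, ∫ ω, h ω ∂Q ≤ ∫ ω, (W ω).toReal ∂Q - ∫ ω, w n ω ∂Q := by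
      intro n
      have hc : Q[w n | m₁] ≤ᵐ[Q] Q[fun ω' => (W ω').toReal | m₁] := by
        refine condExp_mono (hint₂ _ (hwS n)) hWint ?_
        filter_upwards [hwle n] with ω h1 using (le_abs_self _).trans h1
      rw [← integral_condExp hm₁ (f := fun ω' => (W ω').toReal), ← integral_condExp hm₁ (f := w n),
        ← integral_sub integrable_condExp integrable_condExp]
      refine integral_mono_ae hhint (integrable_condExp.sub integrable_condExp) ?_
      filter_upwards [hc, hle g hg _ (hwS n)] with ω h1 h2
      exact max_le (by linarith) (sub_nonneg.2 h1)
    have hlim : Tendsto (fun n => ∫ ω, w n ω ∂Q) atTop (𝓝 (∫ ω, (W ω).toReal ∂Q)) :=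
      tendsto_integral_of_dominated_convergence _
        (fun n => (hint₂ _ (hwS n)).aestronglyMeasurable) hWint hwle hwt
    have hzero : ∫ ω, h ω ∂Q = 0 := by
      refine le_antisymm (ge_of_tendsto' (hlim.const_sub _) hhle |>.trans_eq (sub_self _))
        (integral_nonneg_of_ae hh0)
    filter_upwards [(integral_eq_zero_iff_of_nonneg_ae hh0 hhint).1 hzero] with ω h1
    have h2 : g ω + (Q[fun ω' => (W ω').toReal | m₁]) ω - (Z ω).toReal ≤ h ω := le_max_left _ _
    rw [h1] at h2
    simpa using h2
  have hVle : ∀ᵐ ω ∂Q, V ω ≤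
      (((Z ω).toReal - (Q[fun ω' => (W ω').toReal | m₁]) ω : ℝ) : EReal) := by
    refine hV.2.2 _ fun g hg => ?_
    filter_upwards [hle' g hg] with ω h
    exact EReal.coe_le_coe_iff.2 (by linarith)
  have hVfin : ∀ᵐ ω ∂Q, V ω ≠ ⊤ := by
    filter_upwards [hVle] with ω h
    exact (h.trans_lt (EReal.coe_lt_top _)).ne
  have hZle : ∀ᵐ ω ∂Q, Z ω ≤
      (((V ω).toReal + (Q[fun ω' => (W ω').toReal | m₁]) ω : ℝ) : EReal) := by
    refine hZ.2.2 _ fun f hf => ?_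
    obtain ⟨g, hg, h, hh, hfe⟩ := hsplit f hf
    have hc : Q[h | m₁] ≤ᵐ[Q] Q[fun ω' => (W ω').toReal | m₁] := by
      refine condExp_mono (hint₂ h hh) hWint ?_
      filter_upwards [hW.2.1 h hh, hWfin] with ω h1 h2
      exact EReal.coe_le_coe_iff.1 (h1.trans (EReal.le_coe_toReal h2))
    filter_upwards [hfe, hc, hV.2.1 g hg, hVfin] with ω h1 h2 h3 h4
    have h5 := EReal.coe_le_coe_iff.1 (h3.trans (EReal.le_coe_toReal h4))
    rw [h1]
    exact EReal.coe_le_coe_iff.2 (add_le_add h5 h2)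
  -- A member of `S` keeps `Z` away from `⊥`, so `toReal` loses nothing.
  obtain ⟨f₀, hf₀, -⟩ := hjoin 0 h₁ 0 h₂
  refine ⟨hVfin, hWfin, hWint, ?_⟩
  filter_upwards [hVle, hZle, hVfin, hV0, hfin, hZ.2.1 f₀ hf₀] with ω h1 h2 h3 h4 h5 h6
  have hVb : V ω ≠ ⊥ := ne_bot_of_le_ne_bot EReal.zero_ne_bot h4
  have hZb : Z ω ≠ ⊥ := ne_bot_of_le_ne_bot (EReal.coe_ne_bot _) h6
  rw [← EReal.coe_toReal h3 hVb, EReal.coe_le_coe_iff] at h1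
  rw [← EReal.coe_toReal h5 hZb, EReal.coe_le_coe_iff] at h2
  linarith

end EssSup

/-! ### Time sets, projections and acceptance sets. -/

section Algebra

namespace Horizon

variable {𝕋 : Horizon}

theorem le_last {s : ℕ∞} (hs : s ∈ 𝕋.times) : s ≤ 𝕋.last := by
  cases 𝕋 with
  | finite T => exact hs
  | nat => exact le_top
  | natTop => exact le_top

theorem mem_times_of_le {s t : ℕ} (hst : s ≤ t) (ht : (t : ℕ∞) ∈ 𝕋.times) :
    (s : ℕ∞) ∈ 𝕋.times := by
  cases 𝕋 with
  | finite T =>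
    have h : (t : ℕ∞) ≤ (T : ℕ∞) := ht
    exact le_trans (Nat.cast_le.2 hst) h
  | nat => exact ENat.natCast_ne_top s
  | natTop => exact Set.mem_univ _

theorem coe_lt_succ (t : ℕ) : (t : ℕ∞) < ((t + 1 : ℕ) : ℕ∞) := Nat.cast_lt.2 t.lt_succ_self

theorem lt_last_of_succ_mem {t : ℕ} (ht : ((t + 1 : ℕ) : ℕ∞) ∈ 𝕋.times) :
    (t : ℕ∞) < 𝕋.last :=
  (coe_lt_succ t).trans_le (le_last ht)

theorem le_of_lt_succ {t : ℕ} {r : ℕ∞} (h : r < ((t + 1 : ℕ) : ℕ∞)) : r ≤ t := by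
  have h' : r < (t : ℕ∞) + 1 := by exact_mod_cast h
  exact Order.le_of_lt_add_one h'

theorem succ_le_of_lt {t : ℕ} {r : ℕ∞} (h : (t : ℕ∞) < r) : ((t + 1 : ℕ) : ℕ∞) ≤ r :=
  not_lt.1 fun h' => (le_of_lt_succ h').not_gt h

end Horizon

open Horizon

variable {Ω : Type*} {mΩ : MeasurableSpace Ω} {P : Measure Ω} {ℱ : Filtration ℕ mΩ} {𝕋 : Horizon}

theorem le_sigmaAt {n : ℕ} {s : ℕ∞} (h : (n : ℕ∞) ≤ s) : ℱ n ≤ sigmaAt ℱ s :=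
  le_iSup₂_of_le n h le_rfl

theorem sigmaAt_coe (n : ℕ) : sigmaAt ℱ (n : ℕ∞) = ℱ n :=
  le_antisymm (iSup₂_le fun _ hk => ℱ.mono (Nat.cast_le.1 hk)) (le_sigmaAt le_rfl)

theorem sigmaAt_le (s : ℕ∞) : sigmaAt ℱ s ≤ mΩ := iSup₂_le fun k _ => ℱ.le k

namespace Rinfty

theorem stronglyMeasurable_coe {X : RealProcess Ω} (hX : X ∈ Rinfty P ℱ 𝕋) {t : ℕ}
    (ht : (t : ℕ∞) ∈ 𝕋.times) : StronglyMeasurable[ℱ t] (X t) := by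
  have h := hX.1 t ht
  rwa [sigmaAt_coe] at h

theorem apply_mem_Linfty {X : RealProcess Ω} (hX : X ∈ Rinfty P ℱ 𝕋) {t : ℕ}
    (ht : (t : ℕ∞) ∈ 𝕋.times) : X t ∈ Linfty P (ℱ t) := by
  obtain ⟨C, hC⟩ := hX.2
  exact ⟨stronglyMeasurable_coe hX ht, C, hC.mono fun ω h => h t ht⟩

theorem zero_mem : (0 : RealProcess Ω) ∈ Rinfty P ℱ 𝕋 :=
  ⟨fun _ _ => stronglyMeasurable_zero, 0, by simp⟩

theorem add_mem {X Y : RealProcess Ω} (hX : X ∈ Rinfty P ℱ 𝕋) (hY : Y ∈ Rinfty P ℱ 𝕋) :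
    X + Y ∈ Rinfty P ℱ 𝕋 := by
  obtain ⟨C, hC⟩ := hX.2
  obtain ⟨C', hC'⟩ := hY.2
  refine ⟨fun s hs => (hX.1 s hs).add (hY.1 s hs), C + C', ?_⟩
  filter_upwards [hC, hC'] with ω h h' s hs
  exact (abs_add_le _ _).trans (add_le_add (h s hs) (h' s hs))

theorem stepFrom_mem {t : ℕ} {m : Ω → ℝ} (hm : m ∈ Linfty P (ℱ t)) :
    stepFrom t m ∈ Rinfty P ℱ 𝕋 := by
  obtain ⟨hm, C, hC⟩ := hm
  refine ⟨fun s _ => ?_, C, ?_⟩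
  · by_cases h : (t : ℕ∞) ≤ s
    · have : stepFrom (t : ℕ∞) m s = m := by funext ω; simp [stepFrom, h]
      rw [this]
      exact hm.mono (le_sigmaAt h)
    · have : stepFrom (t : ℕ∞) m s = 0 := by funext ω; simp [stepFrom, h]
      rw [this]
      exact stronglyMeasurable_zero
  · filter_upwards [hC] with ω h s _
    by_cases h' : (t : ℕ∞) ≤ s
    · simpa [stepFrom, h'] using h
    · simpa [stepFrom, h'] using (abs_nonneg _).trans h

theorem proj_mem {X : RealProcess Ω} (hX : X ∈ Rinfty P ℱ 𝕋) (t : ℕ) {s : ℕ∞}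
    (hs : s ∈ 𝕋.times ∨ s = 𝕋.last) : proj t s X ∈ Rinfty P ℱ 𝕋 := by
  have hmin : ∀ r ∈ 𝕋.times, min r s ∈ 𝕋.times := by
    intro r hr
    rcases hs with hs | rfl
    · rcases min_choice r s with h | h <;> rw [h] <;> assumption
    · rwa [min_eq_left (le_last hr)]
  obtain ⟨C, hC⟩ := hX.2
  refine ⟨fun r hr => ?_, max C 0, ?_⟩
  · by_cases h : (t : ℕ∞) ≤ r
    · have : proj t s X r = X (min r s) := by funext ω; simp [proj, h]
      rw [this]
      refine (hX.1 _ (hmin r hr)).mono (iSup₂_le fun k hk => le_sigmaAt ?_)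
      exact hk.trans (min_le_left _ _)
    · have : proj t s X r = 0 := by funext ω; simp [proj, h]
      rw [this]
      exact stronglyMeasurable_zero
  · filter_upwards [hC] with ω h r hr
    by_cases h' : (t : ℕ∞) ≤ r
    · simpa [proj, h'] using Or.inl (h _ (hmin r hr))
    · simp [proj, h']

end Rinfty

theorem proj_apply_of_le {t s r : ℕ∞} (h : t ≤ r) (X : RealProcess Ω) :
    proj t s X r = X (min r s) := by
  funext ω
  simp [proj, h]

theorem proj_apply_of_lt {t s r : ℕ∞} (h : r < t) (X : RealProcess Ω) : proj t s X r = 0 := by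
  funext ω
  simp [proj, h.not_ge]

theorem proj_eq_self_iff {t s : ℕ∞} {X : RealProcess Ω} :
    proj t s X = X ↔ ∀ r, (r < t → X r = 0) ∧ (t ≤ r → X r = X (min r s)) := by
  constructor
  · intro h r
    refine ⟨fun hr => ?_, fun hr => ?_⟩
    · rw [← h, proj_apply_of_lt hr]
    · conv_lhs => rw [← h]
      rw [proj_apply_of_le hr]
  · intro h
    funext r
    rcases lt_or_ge r t with hr | hr
    · rw [proj_apply_of_lt hr, (h r).1 hr]
    · rw [proj_apply_of_le hr, ← (h r).2 hr]

theorem proj_proj {t s : ℕ∞} (hts : t ≤ s) (X : RealProcess Ω) :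
    proj t s (proj t s X) = proj t s X := by
  refine proj_eq_self_iff.2 fun r => ⟨fun hr => proj_apply_of_lt hr X, fun hr => ?_⟩
  rw [proj_apply_of_le hr, proj_apply_of_le (le_min hr hts), min_assoc, min_self]

/-- Projections are idempotent, so their range is their set of fixed points; membership becomes an
equation usable at each time point. -/
theorem mem_RinftyBetween_iff {t : ℕ} {s : ℕ∞} (hts : (t : ℕ∞) ≤ s)
    (hs : s ∈ 𝕋.times ∨ s = 𝕋.last) {X : RealProcess Ω} :
    X ∈ RinftyBetween P ℱ 𝕋 t s ↔ X ∈ Rinfty P ℱ 𝕋 ∧ proj t s X = X := by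
  constructor
  · rintro ⟨X, hX, rfl⟩
    exact ⟨Rinfty.proj_mem hX t hs, proj_proj hts X⟩
  · rintro ⟨hX, h⟩
    exact ⟨X, hX, h⟩

theorem mem_RinftyFrom_iff {t : ℕ} (ht : (t : ℕ∞) ∈ 𝕋.times) {X : RealProcess Ω} :
    X ∈ RinftyFrom P ℱ 𝕋 t ↔ X ∈ Rinfty P ℱ 𝕋 ∧ proj t 𝕋.last X = X :=
  mem_RinftyBetween_iff (le_last ht) (Or.inr rfl)

theorem proj_stepFrom {t : ℕ} {s : ℕ∞} (hts : (t : ℕ∞) ≤ s) (m : Ω → ℝ) :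
    proj t s (stepFrom t m) = stepFrom t m := by
  refine proj_eq_self_iff.2 fun r => ⟨fun hr => ?_, fun hr => ?_⟩
  · funext ω
    simp [stepFrom, hr.not_ge]
  · funext ω
    simp [stepFrom, hr, hts]

theorem proj_add (t s : ℕ∞) (X Y : RealProcess Ω) :
    proj t s (X + Y) = proj t s X + proj t s Y := by
  funext r ω
  by_cases h : t ≤ r <;> simp [proj, h]

theorem stepFrom_mem_RinftyFrom {t : ℕ} (ht : (t : ℕ∞) ∈ 𝕋.times) {m : Ω → ℝ}
    (hm : m ∈ Linfty P (ℱ t)) : stepFrom t m ∈ RinftyFrom P ℱ 𝕋 t :=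
  (mem_RinftyFrom_iff ht).2 ⟨Rinfty.stepFrom_mem hm, proj_stepFrom (le_last ht) m⟩

theorem proj_mem_RinftyFrom {X : RealProcess Ω} (hX : X ∈ Rinfty P ℱ 𝕋) (t : ℕ) :
    proj t 𝕋.last X ∈ RinftyFrom P ℱ 𝕋 t :=
  ⟨X, hX, rfl⟩

theorem add_mem_RinftyFrom {t : ℕ} {X Y : RealProcess Ω} (hX : X ∈ RinftyFrom P ℱ 𝕋 t)
    (hY : Y ∈ RinftyFrom P ℱ 𝕋 t) : X + Y ∈ RinftyFrom P ℱ 𝕋 t := by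
  obtain ⟨X, hX, rfl⟩ := hX
  obtain ⟨Y, hY, rfl⟩ := hY
  exact ⟨X + Y, Rinfty.add_mem hX hY, proj_add _ _ X Y⟩

theorem zero_mem_RinftyBetween (t s : ℕ∞) : (0 : RealProcess Ω) ∈ RinftyBetween P ℱ 𝕋 t s :=
  ⟨0, Rinfty.zero_mem, by funext r ω; simp [proj]⟩

theorem Linfty.neg_mem {m : MeasurableSpace Ω} {f : Ω → ℝ} (hf : f ∈ Linfty P m) :
    -f ∈ Linfty P m := by
  obtain ⟨h, C, hC⟩ := hf
  exact ⟨h.neg, C, by simpa using hC⟩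

theorem Linfty.add_mem {m : MeasurableSpace Ω} {f g : Ω → ℝ} (hf : f ∈ Linfty P m)
    (hg : g ∈ Linfty P m) : f + g ∈ Linfty P m := by
  obtain ⟨h, C, hC⟩ := hf
  obtain ⟨h', C', hC'⟩ := hg
  refine ⟨h.add h', C + C', ?_⟩
  filter_upwards [hC, hC'] with ω h h'
  exact (abs_add_le _ _).trans (add_le_add h h')

theorem Linfty.mono {m m' : MeasurableSpace Ω} (hm : m ≤ m') {f : Ω → ℝ}
    (hf : f ∈ Linfty P m) : f ∈ Linfty P m' :=
  ⟨hf.1.mono hm, hf.2⟩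

/-- The process which is `a` at time `t`, `b` after `t`, and `0` before `t`. -/
noncomputable def oneStep (t : ℕ) (a b : Ω → ℝ) : RealProcess Ω :=
  fun r => if ((t + 1 : ℕ) : ℕ∞) ≤ r then b else if (t : ℕ∞) ≤ r then a else 0

@[simp] theorem oneStep_self (t : ℕ) (a b : Ω → ℝ) : oneStep t a b t = a := by
  simp only [oneStep, (coe_lt_succ t).not_ge, if_false, le_refl, if_true]

theorem oneStep_of_succ_le {t : ℕ} {r : ℕ∞} (h : ((t + 1 : ℕ) : ℕ∞) ≤ r) (a b : Ω → ℝ) :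
    oneStep t a b r = b := by
  simp only [oneStep, h, if_true]

theorem oneStep_of_lt {t : ℕ} {r : ℕ∞} (h : r < t) (a b : Ω → ℝ) :
    oneStep t a b r = 0 := by
  simp only [oneStep, h.not_ge, (h.trans (coe_lt_succ t)).not_ge, if_false]

/-- Puts a cash amount added at `t` into the form required by cash invariance. -/
theorem oneStep_add (t : ℕ) (a b c : Ω → ℝ) :
    oneStep t (a + c) (b + c) = oneStep t a b + stepFrom t c := by
  funext r ω
  rcases lt_or_ge r t with h | h
  · simp [oneStep_of_lt h, stepFrom, h.not_ge]
  · rcases lt_or_ge r ((t + 1 : ℕ) : ℕ∞) with h' | h'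
    · obtain rfl : r = t := le_antisymm (le_of_lt_succ h') h
      simp [stepFrom]
    · simp [oneStep_of_succ_le h', stepFrom, h]

theorem proj_oneStep {t : ℕ} {s : ℕ∞} (hs : ((t + 1 : ℕ) : ℕ∞) ≤ s) (a b : Ω → ℝ) :
    proj t s (oneStep t a b) = oneStep t a b := by
  refine proj_eq_self_iff.2 fun r => ⟨fun hr => oneStep_of_lt hr a b, fun hr => ?_⟩
  rcases lt_or_ge r ((t + 1 : ℕ) : ℕ∞) with h' | h'
  · rw [min_eq_left (h'.le.trans hs)]
  · rw [oneStep_of_succ_le h', oneStep_of_succ_le (le_min h' hs)]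

theorem oneStep_mem_Rinfty {t : ℕ} {a b : Ω → ℝ} (ha : a ∈ Linfty P (ℱ t))
    (hb : b ∈ Linfty P (ℱ (t + 1))) : oneStep t a b ∈ Rinfty P ℱ 𝕋 := by
  have h : oneStep t a b = stepFrom t a + stepFrom (t + 1 : ℕ) (b + -a) := by
    funext r ω
    rcases lt_or_ge r t with h | h
    · simp only [oneStep_of_lt h, stepFrom, h.not_ge, (h.trans (coe_lt_succ t)).not_ge, if_false,
        Pi.zero_apply, Pi.add_apply, add_zero]
    · rcases lt_or_ge r ((t + 1 : ℕ) : ℕ∞) with h' | h'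
      · obtain rfl : r = t := le_antisymm (le_of_lt_succ h') h
        simp only [oneStep_self, stepFrom, h'.not_ge, if_false, le_refl, if_true, Pi.add_apply,
          add_zero]
      · simp only [oneStep_of_succ_le h', stepFrom, h, h', if_true, Pi.add_apply, Pi.neg_apply]
        ring
  rw [h]
  exact Rinfty.add_mem (Rinfty.stepFrom_mem ha) (Rinfty.stepFrom_mem
    (Linfty.add_mem hb (Linfty.neg_mem (Linfty.mono (ℱ.mono t.le_succ) ha))))

theorem oneStep_mem_RinftyBetween {t : ℕ} {a b : Ω → ℝ} (ha : a ∈ Linfty P (ℱ t))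
    (hb : b ∈ Linfty P (ℱ (t + 1))) :
    oneStep t a b ∈ RinftyBetween P ℱ 𝕋 t (t + 1 : ℕ) :=
  ⟨oneStep t a b, oneStep_mem_Rinfty ha hb, proj_oneStep le_rfl a b⟩

theorem eq_oneStep_of_proj_eq {t : ℕ} {X : RealProcess Ω} (h : proj t (t + 1 : ℕ) X = X) :
    X = oneStep t (X t) (X (t + 1 : ℕ)) := by
  rw [proj_eq_self_iff] at h
  funext r
  rcases lt_or_ge r t with hr | hr
  · rw [(h r).1 hr, oneStep_of_lt hr]
  · rcases lt_or_ge r ((t + 1 : ℕ) : ℕ∞) with h' | h'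
    · obtain rfl : r = t := le_antisymm (le_of_lt_succ h') hr
      rw [oneStep_self]
    · rw [oneStep_of_succ_le h', (h r).2 hr, min_eq_right h']

/-! ### Risk measures of one-step processes and decomposition of acceptance sets -/

variable {ρ : ℕ → RealProcess Ω → Ω → ℝ}

theorem risk_mem_Linfty (hρ : IsDynamicConvexRisk P ℱ 𝕋 ρ) {t : ℕ} (ht : (t : ℕ∞) ∈ 𝕋.times)
    {X : RealProcess Ω} (hX : X ∈ Rinfty P ℱ 𝕋) : risk 𝕋 ρ t X ∈ Linfty P (ℱ t) :=
  (hρ t ht).mem_Linfty _ (proj_mem_RinftyFrom hX t)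

theorem risk_add_stepFrom (hρ : IsDynamicConvexRisk P ℱ 𝕋 ρ) {t : ℕ} (ht : (t : ℕ∞) ∈ 𝕋.times)
    {X : RealProcess Ω} (hX : X ∈ Rinfty P ℱ 𝕋) {m : Ω → ℝ} (hm : m ∈ Linfty P (ℱ t)) :
    ∀ᵐ ω ∂P, risk 𝕋 ρ t (X + stepFrom t m) ω = risk 𝕋 ρ t X ω - m ω := by
  have h := (hρ t ht).cash_invariance _ (proj_mem_RinftyFrom hX t) m hm
  unfold risk
  rwa [proj_add, proj_stepFrom (le_last ht)]

theorem risk_succ_oneStep (hρ : IsDynamicConvexRisk P ℱ 𝕋 ρ) {t : ℕ}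
    (ht : ((t + 1 : ℕ) : ℕ∞) ∈ 𝕋.times) (a : Ω → ℝ) {b : Ω → ℝ}
    (hb : b ∈ Linfty P (ℱ (t + 1))) :
    ∀ᵐ ω ∂P, risk 𝕋 ρ (t + 1) (oneStep t a b) ω = -b ω := by
  have h := (hρ _ ht).cash_invariance 0 (zero_mem_RinftyBetween _ _) b hb
  have he : proj (t + 1 : ℕ) 𝕋.last (oneStep t a b) = 0 + stepFrom (t + 1 : ℕ) b := by
    funext r ω
    rcases lt_or_ge r ((t + 1 : ℕ) : ℕ∞) with hr | hr
    · rw [proj_apply_of_lt hr]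
      simp only [stepFrom, hr.not_ge, Pi.add_apply, Pi.zero_apply, if_false, add_zero]
    · rw [proj_apply_of_le hr, oneStep_of_succ_le (le_min hr (le_last ht))]
      simp only [stepFrom, hr, Pi.add_apply, Pi.zero_apply, if_true, zero_add]
  filter_upwards [h, (hρ _ ht).normalization] with ω h h0
  unfold risk
  rw [he, h, h0, zero_sub]

/-- Both positions agree at `t` and have the same risk at `t + 1`, so time consistency applies; only
this inequality is needed later. -/
theorem risk_le_of_oneStep (hρ : IsDynamicConvexRisk P ℱ 𝕋 ρ) (hcons : TimeConsistent P ℱ 𝕋 ρ)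
    {t : ℕ} (ht : ((t + 1 : ℕ) : ℕ∞) ∈ 𝕋.times) {X : RealProcess Ω} (hX : X ∈ Rinfty P ℱ 𝕋) :
    ∀ᵐ ω ∂P, ρ t (oneStep t (X t) (-risk 𝕋 ρ (t + 1) X)) ω ≤ risk 𝕋 ρ t X ω := by
  have ht' := mem_times_of_le t.le_succ ht
  have hb := Linfty.neg_mem (risk_mem_Linfty hρ ht hX)
  have h := hcons t (lt_last_of_succ_mem ht) (oneStep t (X t) (-risk 𝕋 ρ (t + 1) X))
    (oneStep_mem_Rinfty (Rinfty.apply_mem_Linfty hX ht') hb) X hX (by simp)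
    (by filter_upwards [risk_succ_oneStep hρ ht (X t) hb] with ω h
        rw [h]
        simp)
  rw [risk, proj_oneStep (le_last ht)] at h
  exact h

/-- Adding the cash amount `c` cancels the risk bound. The case `c = 0` yields the splitting of
acceptable positions, the case `c = ρ_t(X)` the supermartingale property of the risk process. -/
theorem oneStep_mem_acceptanceSetStep (hρ : IsDynamicConvexRisk P ℱ 𝕋 ρ)
    (hcons : TimeConsistent P ℱ 𝕋 ρ) {t : ℕ} (ht : ((t + 1 : ℕ) : ℕ∞) ∈ 𝕋.times)
    {X : RealProcess Ω} (hX : X ∈ Rinfty P ℱ 𝕋) {c : Ω → ℝ} (hc : c ∈ Linfty P (ℱ t))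
    (hle : ∀ᵐ ω ∂P, risk 𝕋 ρ t X ω ≤ c ω) :
    oneStep t (X t + c) (-risk 𝕋 ρ (t + 1) X + c) ∈ acceptanceSetStep P ℱ 𝕋 ρ t := by
  have ht' := mem_times_of_le t.le_succ ht
  have ha := Rinfty.apply_mem_Linfty hX ht'
  have hb := Linfty.neg_mem (risk_mem_Linfty hρ ht hX)
  refine ⟨oneStep_mem_RinftyBetween (Linfty.add_mem ha hc)
    (Linfty.add_mem hb (Linfty.mono (ℱ.mono t.le_succ) hc)), ?_⟩
  have hm : oneStep t (X t) (-risk 𝕋 ρ (t + 1) X) ∈ RinftyFrom P ℱ 𝕋 t :=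
    (mem_RinftyFrom_iff ht').2 ⟨oneStep_mem_Rinfty ha hb, proj_oneStep (le_last ht) _ _⟩
  rw [oneStep_add]
  filter_upwards [(hρ t ht').cash_invariance _ hm c hc, risk_le_of_oneStep hρ hcons ht hX, hle]
    with ω h1 h2 h3
  rw [h1]
  linarith

theorem zero_mem_acceptanceSet (hρ : IsDynamicConvexRisk P ℱ 𝕋 ρ) {t : ℕ}
    (ht : (t : ℕ∞) ∈ 𝕋.times) : 0 ∈ acceptanceSet P ℱ 𝕋 ρ t :=
  ⟨zero_mem_RinftyBetween _ _, (hρ t ht).normalization.mono fun _ h => h.le⟩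

theorem zero_mem_acceptanceSetStep (hρ : IsDynamicConvexRisk P ℱ 𝕋 ρ) {t : ℕ}
    (ht : (t : ℕ∞) ∈ 𝕋.times) : 0 ∈ acceptanceSetStep P ℱ 𝕋 ρ t :=
  ⟨zero_mem_RinftyBetween _ _, (hρ t ht).normalization.mono fun _ h => h.le⟩

theorem risk_eq_of_mem_RinftyFrom {t : ℕ} (ht : (t : ℕ∞) ∈ 𝕋.times) {X : RealProcess Ω}
    (hX : X ∈ RinftyFrom P ℱ 𝕋 t) : risk 𝕋 ρ t X = ρ t X := by
  rw [risk, ((mem_RinftyFrom_iff ht).1 hX).2]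

/-- Time consistency: sums of acceptable one-step positions and of positions acceptable at
`t + 1` are acceptable. -/
theorem add_mem_acceptanceSet (hρ : IsDynamicConvexRisk P ℱ 𝕋 ρ)
    (hcons : TimeConsistent P ℱ 𝕋 ρ) {t : ℕ} (ht : ((t + 1 : ℕ) : ℕ∞) ∈ 𝕋.times)
    {Y Z : RealProcess Ω} (hY : Y ∈ acceptanceSetStep P ℱ 𝕋 ρ t)
    (hZ : Z ∈ acceptanceSet P ℱ 𝕋 ρ (t + 1)) : Y + Z ∈ acceptanceSet P ℱ 𝕋 ρ t := by
  have ht' := mem_times_of_le t.le_succ ht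
  obtain ⟨hYR, hYe⟩ := (mem_RinftyBetween_iff (coe_lt_succ t).le (Or.inl ht)).1 hY.1
  obtain ⟨hZR, hZe⟩ := (mem_RinftyFrom_iff ht).1 hZ.1
  have hYo := eq_oneStep_of_proj_eq hYe
  have hYp : proj t 𝕋.last Y = Y := by rw [hYo, proj_oneStep (le_last ht)]
  have hZt : ∀ r < ((t + 1 : ℕ) : ℕ∞), Z r = 0 := fun r hr => (proj_eq_self_iff.1 hZe r).1 hr
  have hZp : proj t 𝕋.last Z = Z := by
    refine proj_eq_self_iff.2 fun r => ⟨fun hr => hZt r (hr.trans (coe_lt_succ t)), fun hr => ?_⟩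
    rcases lt_or_ge r ((t + 1 : ℕ) : ℕ∞) with h' | h'
    · rw [min_eq_left (h'.le.trans (le_last ht))]
    · exact (proj_eq_self_iff.1 hZe r).2 h'
  have hYb := Rinfty.apply_mem_Linfty hYR ht
  have h1 : ∀ᵐ ω ∂P, risk 𝕋 ρ (t + 1) (Y + Z) ω ≤ risk 𝕋 ρ (t + 1) Y ω := by
    -- From `t + 1` on, `Y` is constant in time, so seen from there it is a cash payment added to
    -- `Z`.
    have he : proj (t + 1 : ℕ) 𝕋.last (Y + Z)
        = proj (t + 1 : ℕ) 𝕋.last (Z + stepFrom (t + 1 : ℕ) (Y (t + 1 : ℕ))) := by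
      rw [add_comm Z, proj_add, proj_add]
      congr 1
      funext r ω
      rcases lt_or_ge r ((t + 1 : ℕ) : ℕ∞) with hr | hr
      · rw [proj_apply_of_lt hr, proj_apply_of_lt hr]
      · rw [proj_apply_of_le hr, proj_apply_of_le hr, hYo,
          oneStep_of_succ_le (le_min hr (le_last ht)), oneStep_of_succ_le le_rfl]
        simp only [stepFrom, le_min hr (le_last ht), if_true]
    have h2 := risk_succ_oneStep hρ ht (Y t) hYb
    rw [← hYo] at h2
    filter_upwards [risk_add_stepFrom hρ ht hZR hYb, h2, hZ.2] with ω h3 h4 h5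
    rw [h4, risk, he]
    rw [risk_eq_of_mem_RinftyFrom ht hZ.1] at h3
    rw [risk] at h3
    linarith
  have h2 := hcons t (lt_last_of_succ_mem ht) (Y + Z) (Rinfty.add_mem hYR hZR) Y hYR
    (by simp [hZt _ (coe_lt_succ t)]) h1
  have hm : Y + Z ∈ RinftyFrom P ℱ 𝕋 t :=
    (mem_RinftyFrom_iff ht').2 ⟨Rinfty.add_mem hYR hZR, by rw [proj_add, hYp, hZp]⟩
  refine ⟨hm, ?_⟩
  rw [risk_eq_of_mem_RinftyFrom ht' hm] at h2
  rw [risk, hYp] at h2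
  filter_upwards [h2, hY.2] with ω h3 h4 using h3.trans h4

/-- Time consistency: every acceptable position splits into an acceptable one-step position and a
position that is acceptable at `t + 1`. -/
theorem exists_add_of_mem_acceptanceSet (hρ : IsDynamicConvexRisk P ℱ 𝕋 ρ)
    (hcons : TimeConsistent P ℱ 𝕋 ρ) {t : ℕ} (ht : ((t + 1 : ℕ) : ℕ∞) ∈ 𝕋.times)
    {X : RealProcess Ω} (hX : X ∈ acceptanceSet P ℱ 𝕋 ρ t) :
    ∃ Y ∈ acceptanceSetStep P ℱ 𝕋 ρ t, ∃ Z ∈ acceptanceSet P ℱ 𝕋 ρ (t + 1), X = Y + Z := by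
  have ht' := mem_times_of_le t.le_succ ht
  obtain ⟨hXR, hXe⟩ := (mem_RinftyFrom_iff ht').1 hX.1
  have hm := risk_mem_Linfty hρ ht hXR
  have h0 : (0 : Ω → ℝ) ∈ Linfty P (ℱ t) := ⟨stronglyMeasurable_zero, 0, by simp⟩
  have hY := oneStep_mem_acceptanceSetStep hρ hcons ht hXR h0
    (by rw [risk_eq_of_mem_RinftyFrom ht' hX.1]; exact hX.2)
  rw [add_zero, add_zero] at hY
  -- The remainder is `X` from `t + 1` on, topped up by its own risk; the frozen value `-ρ_{t+1}(X)`
  -- cancels that top-up in the sum.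
  refine ⟨_, hY, proj (t + 1 : ℕ) 𝕋.last X + stepFrom (t + 1 : ℕ) (risk 𝕋 ρ (t + 1) X), ⟨?_, ?_⟩, ?_⟩
  · exact add_mem_RinftyFrom (proj_mem_RinftyFrom hXR _) (stepFrom_mem_RinftyFrom ht hm)
  · filter_upwards [(hρ _ ht).cash_invariance _ (proj_mem_RinftyFrom hXR _) _ hm] with ω h
    rw [h, risk, sub_self]
  · have hXe' := proj_eq_self_iff.1 hXe
    funext r ω
    rcases lt_or_ge r t with h | h
    · have h' := h.trans (coe_lt_succ t)
      simp only [Pi.add_apply, oneStep_of_lt h, proj_apply_of_lt h', stepFrom, h'.not_ge, if_false,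
        (hXe' r).1 h, Pi.zero_apply, add_zero]
    · rcases lt_or_ge r ((t + 1 : ℕ) : ℕ∞) with h' | h'
      · obtain rfl : r = t := le_antisymm (le_of_lt_succ h') h
        simp only [Pi.add_apply, oneStep_self, proj_apply_of_lt h', stepFrom, h'.not_ge, if_false,
          Pi.zero_apply, add_zero]
      · simp only [Pi.add_apply, oneStep_of_succ_le h', proj_apply_of_le h', stepFrom, h', if_true,
          Pi.neg_apply, ← (hXe' r).2 h]
        ring

/-- Acceptance sets are stable under pasting along events of the current `σ`-field. -/
theorem pasting_mem_acceptanceSet (hρ : IsDynamicConvexRisk P ℱ 𝕋 ρ) {t : ℕ}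
    (ht : (t : ℕ∞) ∈ 𝕋.times) {X Y : RealProcess Ω} (hX : X ∈ acceptanceSet P ℱ 𝕋 ρ t)
    (hY : Y ∈ acceptanceSet P ℱ 𝕋 ρ t) {l : Ω → ℝ} (hl : StronglyMeasurable[ℱ t] l)
    (hl01 : ∀ ω, 0 ≤ l ω ∧ l ω ≤ 1) :
    (fun s ω => l ω * X s ω + (1 - l ω) * Y s ω) ∈ acceptanceSet P ℱ 𝕋 ρ t := by
  obtain ⟨hXR, hXe⟩ := (mem_RinftyFrom_iff ht).1 hX.1
  obtain ⟨hYR, hYe⟩ := (mem_RinftyFrom_iff ht).1 hY.1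
  rw [proj_eq_self_iff] at hXe hYe
  have hlL : l ∈ Linfty P (ℱ t) := by
    refine ⟨hl, 1, Eventually.of_forall fun ω => ?_⟩
    rw [abs_of_nonneg (hl01 ω).1]
    exact (hl01 ω).2
  constructor
  · refine (mem_RinftyFrom_iff ht).2 ⟨⟨fun s hs => ?_, ?_⟩, ?_⟩
    · rcases lt_or_ge s t with h | h
      · simp only [(hXe s).1 h, (hYe s).1 h, Pi.zero_apply, mul_zero, add_zero]
        exact stronglyMeasurable_const
      · have hl' := hl.mono (le_sigmaAt h)
        exact (hl'.mul (hXR.1 s hs)).add ((stronglyMeasurable_const.sub hl').mul (hYR.1 s hs))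
    · obtain ⟨C, hC⟩ := hXR.2
      obtain ⟨C', hC'⟩ := hYR.2
      refine ⟨C + C', ?_⟩
      filter_upwards [hC, hC'] with ω h h' s hs
      have h1 := h s hs
      have h2 := h' s hs
      have h3 := abs_nonneg (X s ω)
      have h4 := abs_nonneg (Y s ω)
      refine (abs_add_le _ _).trans (add_le_add ?_ ?_)
      · rw [abs_mul, abs_of_nonneg (hl01 ω).1]
        exact (mul_le_of_le_one_left h3 (hl01 ω).2).trans h1
      · rw [abs_mul, abs_of_nonneg (by linarith [(hl01 ω).2])]
        exact (mul_le_of_le_one_left h4 (by linarith [(hl01 ω).1])).trans h2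
    · refine proj_eq_self_iff.2 fun r => ⟨fun hr => ?_, fun hr => ?_⟩
      · funext ω
        simp [(hXe r).1 hr, (hYe r).1 hr]
      · funext ω
        rw [(hXe r).2 hr, (hYe r).2 hr]
  · filter_upwards [(hρ t ht).convexity X hX.1 Y hY.1 l hlL (Eventually.of_forall hl01), hX.2, hY.2]
      with ω h h1 h2
    have h3 := mul_nonneg (hl01 ω).1 (neg_nonneg.2 h1)
    have h4 := mul_nonneg (sub_nonneg.2 (hl01 ω).2) (neg_nonneg.2 h2)
    linarith

end Algebra

/-! ### Change of measure and mass of the discounting process. -/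

section Models

open Horizon

variable {Ω : Type*} {mΩ : MeasurableSpace Ω} {P Q : Measure Ω} {ℱ : Filtration ℕ mΩ}
  {𝕋 : Horizon} {D : RealProcess Ω}

/-- Measurability of the event at a finite time is essential: on larger `σ`-fields `Q` need not be
absolutely continuous. -/
theorem LocallyAbsolutelyContinuous.ae_of_ae (hQ : LocallyAbsolutelyContinuous P Q ℱ 𝕋) {t : ℕ}
    (ht : (t : ℕ∞) ∈ 𝕋.times) {s : Set Ω} (hs : MeasurableSet[ℱ t] s) (h : ∀ᵐ ω ∂P, ω ∈ s) :
    ∀ᵐ ω ∂Q, ω ∈ s := by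
  have h1 : P.trim (ℱ.le t) sᶜ = 0 := by
    rw [trim_measurableSet_eq (ℱ.le t) hs.compl]
    exact h
  have h2 := hQ t ht h1
  rwa [trim_measurableSet_eq (ℱ.le t) hs.compl] at h2

theorem LocallyAbsolutelyContinuous.ae_bound_of_Linfty
    (hQ : LocallyAbsolutelyContinuous P Q ℱ 𝕋) {t : ℕ} (ht : (t : ℕ∞) ∈ 𝕋.times) {f : Ω → ℝ}
    (hf : StronglyMeasurable[ℱ t] f) {C : ℝ} (hC : ∀ᵐ ω ∂P, |f ω| ≤ C) :
    ∀ᵐ ω ∂Q, |f ω| ≤ C := by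
  refine hQ.ae_of_ae ht (s := {ω | |f ω| ≤ C}) ?_ hC
  exact measurableSet_le (continuous_abs.measurable.comp hf.measurable) measurable_const

/-- On `ℱ n`, `Q` has density `M_n`, hence is at most `c P` where `M_n ≤ c`. -/
theorem lintegral_indicator_density_le [IsFiniteMeasure P] [IsFiniteMeasure Q] {n : ℕ}
    (hQ : Q.trim (ℱ.le n) ≪ P.trim (ℱ.le n)) {f : Ω → ENNReal} (hf : Measurable[ℱ n] f)
    (c : ENNReal) :
    ∫⁻ ω in {ω | densityProcess P Q ℱ n ω ≤ c}, f ω ∂Q ≤ c * ∫⁻ ω, f ω ∂P := by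
  have hM : Measurable[ℱ n] (densityProcess P Q ℱ n) := Measure.measurable_rnDeriv _ _
  have hs : MeasurableSet[ℱ n] {ω | densityProcess P Q ℱ n ω ≤ c} :=
    measurableSet_le hM measurable_const
  have hg : Measurable[ℱ n] ({ω | densityProcess P Q ℱ n ω ≤ c}.indicator f) := hf.indicator hs
  rw [← lintegral_indicator (ℱ.le n _ hs), ← lintegral_trim (ℱ.le n) hg,
    ← lintegral_rnDeriv_mul hQ hg.aemeasurable, ← lintegral_trim (ℱ.le n) hf,
    ← lintegral_const_mul c hf]
  refine lintegral_mono fun ω => ?_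
  by_cases h : densityProcess P Q ℱ n ω ≤ c
  · rw [Set.indicator_of_mem (by exact h)]
    exact mul_le_mul_left h _
  · rw [Set.indicator_of_notMem (by exact h), mul_zero]
    exact zero_le

/-- On the set where the densities stay bounded, `Q` is absolutely continuous with respect to `P`
on the terminal `σ`-field. -/
theorem ae_densityLimit_eq_top [IsFiniteMeasure P] [IsFiniteMeasure Q]
    (hQ : ∀ n, Q.trim (ℱ.le n) ≪ P.trim (ℱ.le n)) {N : Set Ω}
    (hN : MeasurableSet[⨆ n, ℱ n] N) (hPN : P N = 0) :
    ∀ᵐ ω ∂Q, ω ∈ N → densityLimit P Q ℱ ω = ⊤ := by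
  have hle : (⨆ n, ℱ n) ≤ mΩ := iSup_le ℱ.le
  let g : Ω → ℝ := N.indicator fun _ => 1
  have hg : StronglyMeasurable[⨆ n, ℱ n] g := stronglyMeasurable_const.indicator hN
  -- Conditioning under `P + Q` yields one approximating martingale that converges to the indicator
  -- of `N` under both measures.
  have hgint : Integrable g (P + Q) := (integrable_const 1).indicator (hle _ hN)
  have hlim := hgint.tendsto_ae_condExp (ℱ := ℱ) hg
  have hle1 : ∀ᵐ ω ∂(P + Q), ∀ n, ((P + Q)[g | ℱ n]) ω ≤ 1 := by
    rw [ae_all_iff]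
    intro n
    have h1 := condExp_mono (m := ℱ n) hgint (integrable_const (1 : ℝ))
      (Eventually.of_forall fun ω => Set.indicator_le_self' (by simp) ω)
    rw [condExp_const (ℱ.le n)] at h1
    exact h1
  have hdom : ∀ᵐ ω ∂(P + Q), ∀ n, ENNReal.ofReal (((P + Q)[g | ℱ n]) ω) ≤ 1 := by
    filter_upwards [hle1] with ω h n
    simpa using h n
  have hm : ∀ n, Measurable[ℱ n] fun ω => ENNReal.ofReal (((P + Q)[g | ℱ n]) ω) := fun n =>
    ENNReal.measurable_ofReal.comp stronglyMeasurable_condExp.measurable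
  have hlim' : ∀ᵐ ω ∂(P + Q), Tendsto (fun n => ENNReal.ofReal (((P + Q)[g | ℱ n]) ω)) atTop
      (𝓝 (ENNReal.ofReal (g ω))) :=
    hlim.mono fun ω h => (ENNReal.continuous_ofReal.tendsto _).comp h
  have hPQ : ∀ {p : Ω → Prop}, (∀ᵐ ω ∂(P + Q), p ω) → (∀ᵐ ω ∂P, p ω) ∧ ∀ᵐ ω ∂Q, p ω :=
    fun h => ae_add_measure_iff.1 h
  have hP0 : ∫⁻ ω, ENNReal.ofReal (g ω) ∂P = 0 := by
    have : (fun ω => ENNReal.ofReal (g ω)) =ᵐ[P] fun _ => 0 := by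
      filter_upwards [show ∀ᵐ ω ∂P, ω ∉ N from measure_eq_zero_iff_ae_notMem.1 hPN] with ω h
      simp [g, h]
    rw [lintegral_congr_ae this, lintegral_zero]
  have hzero : ∀ c : ℕ, ∀ᵐ ω ∂Q, (∀ n, densityProcess P Q ℱ n ω ≤ c) → ω ∉ N := by
    intro c
    -- On `B` every density is at most `c`, so `Q ≤ c P` holds for each `ℱ n`-measurable
    -- approximation, and in the limit for the indicator of `N`.
    let B : Set Ω := {ω | ∀ n, densityProcess P Q ℱ n ω ≤ c}
    have hB : MeasurableSet B := by
      have : B = ⋂ n, {ω | densityProcess P Q ℱ n ω ≤ c} := by ext; simp [B]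
      rw [this]
      exact MeasurableSet.iInter fun n => measurableSet_le
        ((Measure.measurable_rnDeriv _ _).mono (ℱ.le n) le_rfl) measurable_const
    have h1 : Tendsto (fun n => ∫⁻ ω in B, ENNReal.ofReal (((P + Q)[g | ℱ n]) ω) ∂Q) atTop
        (𝓝 (∫⁻ ω in B, ENNReal.ofReal (g ω) ∂Q)) := by
      refine tendsto_lintegral_of_dominated_convergence (fun _ => 1)
        (fun n => (hm n).mono (ℱ.le n) le_rfl) (fun n => ?_) (by simp)
        (ae_restrict_of_ae (hPQ hlim').2)
      exact ae_restrict_of_ae ((hPQ hdom).2.mono fun ω h => h n)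
    have h2 : Tendsto (fun n => c * ∫⁻ ω, ENNReal.ofReal (((P + Q)[g | ℱ n]) ω) ∂P) atTop
        (𝓝 (c * ∫⁻ ω, ENNReal.ofReal (g ω) ∂P)) := by
      refine ENNReal.Tendsto.const_mul ?_ (Or.inr (by simp))
      refine tendsto_lintegral_of_dominated_convergence (fun _ => 1)
        (fun n => (hm n).mono (ℱ.le n) le_rfl) (fun n => ?_) (by simp) (hPQ hlim').1
      exact (hPQ hdom).1.mono fun ω h => h n
    have h3 : ∫⁻ ω in B, ENNReal.ofReal (g ω) ∂Q ≤ c * ∫⁻ ω, ENNReal.ofReal (g ω) ∂P := by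
      refine le_of_tendsto_of_tendsto' h1 h2 fun n => ?_
      refine le_trans (lintegral_mono_set fun ω (hω : ω ∈ B) => ?_)
        (lintegral_indicator_density_le (hQ n) (hm n) c)
      exact hω n
    have hgm : Measurable fun ω => ENNReal.ofReal (g ω) :=
      ENNReal.measurable_ofReal.comp (hg.measurable.mono hle le_rfl)
    rw [hP0, mul_zero, nonpos_iff_eq_zero, lintegral_eq_zero_iff hgm, EventuallyEq,
      ae_restrict_iff' hB] at h3
    filter_upwards [h3] with ω h h' hN'
    have := h h'
    simp [g, hN'] at this
  have hfin : ∀ᵐ ω ∂Q, ∀ n, densityProcess P Q ℱ n ω < ⊤ := by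
    rw [ae_all_iff]
    exact fun n => ae_of_ae_trim (ℱ.le n) ((hQ n).ae_le (Measure.rnDeriv_lt_top _ _))
  filter_upwards [ae_all_iff.2 hzero, hfin] with ω h hf hωN
  by_contra hne
  obtain ⟨c, hc1, hc2⟩ := exists_between (lt_top_iff_ne_top.2 hne)
  obtain ⟨n₀, hn₀⟩ := eventually_atTop.1 (eventually_lt_of_limsup_lt hc1)
  -- `c` bounds the densities from `n₀` on; the sum covers the finitely many earlier ones. Hence `ω`
  -- lies in some `B`.
  have hb : c + ∑ k ∈ Finset.range n₀, densityProcess P Q ℱ k ω < ⊤ :=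
    ENNReal.add_lt_top.2 ⟨hc2, ENNReal.sum_lt_top.2 fun k _ => hf k⟩
  obtain ⟨K, hK⟩ := ENNReal.exists_nat_gt hb.ne
  refine h K (fun n => le_trans ?_ hK.le) hωN
  rcases lt_or_ge n n₀ with hn | hn
  · exact le_add_left (Finset.single_le_sum (f := fun k => densityProcess P Q ℱ k ω)
      (fun _ _ => zero_le) (Finset.mem_range.2 hn))
  · exact le_add_right (hn₀ n hn).le

/-! ### The optional random measure of a discounting process -/

theorem Horizon.eq_natTop_of_top_mem (h : ⊤ ∈ 𝕋.times) : 𝕋 = natTop := by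
  cases 𝕋 with
  | finite T => exact absurd (top_le_iff.1 (show (⊤ : ℕ∞) ≤ T from h)) (ENat.natCast_ne_top T)
  | nat => exact absurd rfl (show (⊤ : ℕ∞) ≠ ⊤ from h)
  | natTop => rfl

theorem optionalMeasure_top (ω : Ω) : optionalMeasure 𝕋 D ⊤ ω = D ⊤ ω := by
  simp [optionalMeasure]

open Classical in
theorem optionalMeasure_coe (n : ℕ) (ω : Ω) : optionalMeasure 𝕋 D n ω =
    D n ω - if ((n + 1 : ℕ) : ℕ∞) ∈ 𝕋.times then D (n + 1 : ℕ) ω else 0 := by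
  simp [optionalMeasure]

theorem optionalMeasure_of_succ_mem {n : ℕ} (hn : ((n + 1 : ℕ) : ℕ∞) ∈ 𝕋.times) (ω : Ω) :
    optionalMeasure 𝕋 D n ω = D n ω - D (n + 1 : ℕ) ω := by
  rw [optionalMeasure_coe, if_pos hn]

/-- The masses telescope. What remains at the end is the limit of `D`: zero or, if infinity is a
time point, exactly the atom there. -/
theorem hasSum_optionalMeasure {ω : Ω} (h0 : ∀ s ∈ 𝕋.times, 0 ≤ optionalMeasure 𝕋 D s ω)
    (hnat : 𝕋 = nat → Tendsto (fun n : ℕ => D n ω) atTop (𝓝 0))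
    (htop : 𝕋 = natTop → Tendsto (fun n : ℕ => D n ω) atTop (𝓝 (D ⊤ ω)))
    {t : ℕ} (ht : (t : ℕ∞) ∈ 𝕋.times) :
    HasSum (fun s : 𝕋.timesFrom t => optionalMeasure 𝕋 D s ω) (D t ω) := by
  classical
  -- Extending by zero beyond the horizon incorporates `D_{T+1} = 0` and treats all three time sets
  -- at once.
  let d : ℕ → ℝ := fun n => if (n : ℕ∞) ∈ 𝕋.times then D n ω else 0
  let l : ℝ := if ⊤ ∈ 𝕋.times then D ⊤ ω else 0
  have hd : Tendsto d atTop (𝓝 l) := by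
    cases 𝕋 with
    | finite T =>
      have hl : l = 0 := if_neg fun h => by cases eq_natTop_of_top_mem h
      rw [hl]
      refine tendsto_const_nhds.congr' ?_
      filter_upwards [eventually_gt_atTop T] with n hn
      refine (if_neg fun h => ?_).symm
      exact absurd (Nat.cast_le.1 (show (n : ℕ∞) ≤ (T : ℕ∞) from h)) hn.not_ge
    | nat =>
      have hl : l = 0 := if_neg fun h => by cases eq_natTop_of_top_mem h
      rw [hl]
      exact (hnat rfl).congr fun n => (if_pos (ENat.natCast_ne_top n)).symm
    | natTop =>
      have hl : l = D ⊤ ω := if_pos (Set.mem_univ _)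
      rw [hl]
      exact (htop rfl).congr fun n => (if_pos (Set.mem_univ _)).symm
  let F : ℕ∞ → ℝ := (𝕋.timesFrom t).indicator fun s => optionalMeasure 𝕋 D s ω
  have hFin : ∀ s ∈ 𝕋.timesFrom t, F s = optionalMeasure 𝕋 D s ω := fun s hs =>
    Set.indicator_of_mem hs _
  have hFout : ∀ s ∉ 𝕋.timesFrom t, F s = 0 := fun s hs => Set.indicator_of_notMem hs _
  -- With `max · t`, indices below `t` give the difference `d t - d t = 0`, so the telescoping
  -- starts at `t`.
  have hFn : ∀ n : ℕ, F n = d (max n t) - d (max (n + 1) t) := by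
    intro n
    by_cases hn : (n : ℕ∞) ∈ 𝕋.timesFrom t
    · have htn : t ≤ n := Nat.cast_le.1 hn.2
      rw [hFin _ hn, max_eq_left htn, max_eq_left (htn.trans n.le_succ),
        optionalMeasure_coe]
      simp only [d, if_pos hn.1]
    · rw [hFout _ hn]
      rcases le_or_gt t n with htn | htn
      · have h1 : (n : ℕ∞) ∉ 𝕋.times := fun h => hn ⟨h, Nat.cast_le.2 htn⟩
        have h2 : ((n + 1 : ℕ) : ℕ∞) ∉ 𝕋.times := fun h => h1 (mem_times_of_le n.le_succ h)
        rw [max_eq_left htn, max_eq_left (htn.trans n.le_succ)]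
        simp only [d, if_neg h1, if_neg h2, sub_zero]
      · rw [max_eq_right htn.le, max_eq_right htn, sub_self]
  have hF0 : ∀ n : ℕ, 0 ≤ F n := fun n =>
    Set.indicator_nonneg (fun s hs => h0 s hs.1) _
  have hsum : HasSum (fun n : ℕ => F n) (d t - l) := by
    rw [hasSum_iff_tendsto_nat_of_nonneg hF0]
    simp only [hFn]
    have h1 : ∀ n, ∑ i ∈ Finset.range n, (d (max i t) - d (max (i + 1) t)) =
        d t - d (max n t) := fun n => by
      rw [Finset.sum_range_sub' (fun i => d (max i t)), max_eq_right (Nat.zero_le t)]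
    simp only [h1]
    refine (hd.comp ?_).const_sub _
    exact tendsto_atTop_mono (fun n => le_max_left n t) tendsto_id
  have hcoe : Function.Injective ((↑) : ℕ → ℕ∞) := Nat.cast_injective
  -- The sum over `ℕ∞` is the sum over the finite times plus a single atom at `⊤`.
  have h1 : HasSum (Function.update F ⊤ 0) (d t - l) := by
    have he : Function.update F ⊤ 0 ∘ ((↑) : ℕ → ℕ∞) = fun n : ℕ => F n := by
      funext n
      exact Function.update_of_ne (ENat.natCast_ne_top n) _ _
    refine (hcoe.hasSum_iff fun x hx => ?_).1 (he ▸ hsum)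
    have : x = ⊤ := by
      by_contra h
      exact hx ⟨x.toNat, ENat.natCast_toNat h⟩
    rw [this, Function.update_self]
  have h2 : HasSum (fun s : ℕ∞ => if s = ⊤ then F ⊤ else 0) (F ⊤) := hasSum_ite_eq ⊤ (F ⊤)
  have h3 := h1.add h2
  have hFtop : F ⊤ = l := by
    by_cases h : ⊤ ∈ 𝕋.times
    · simp only [F, l, if_pos h]
      rw [← optionalMeasure_top (𝕋 := 𝕋) (D := D) ω]
      exact hFin ⊤ ⟨h, le_top⟩
    · simp only [F, l, if_neg h]
      exact hFout ⊤ fun h' => h h'.1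
  have hdt : d t = D t ω := if_pos ht
  rw [hFtop, sub_add_cancel, hdt] at h3
  have hF : F = fun s => Function.update F ⊤ 0 s + if s = ⊤ then l else 0 := by
    funext s
    by_cases hs : s = ⊤
    · subst hs
      rw [Function.update_self, if_pos rfl, zero_add, hFtop]
    · rw [Function.update_of_ne hs, if_neg hs, add_zero]
  rw [← hF] at h3
  exact (hasSum_subtype_iff_indicator (f := fun s => optionalMeasure 𝕋 D s ω)).2 h3

theorem IsDiscounting.ae_optionalMeasure (hD : IsDiscounting P Q ℱ 𝕋 D) :
    ∀ᵐ ω ∂Q, (∀ s ∈ 𝕋.times, 0 ≤ optionalMeasure 𝕋 D s ω) ∧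
      ∀ t : ℕ, (t : ℕ∞) ∈ 𝕋.times → (0 ≤ D t ω ∧ D t ω ≤ 1) ∧
        HasSum (fun s : 𝕋.timesFrom t => optionalMeasure 𝕋 D s ω) (D t ω) := by
  have h1 : ∀ᵐ ω ∂Q, ∀ s ∈ 𝕋.times, 0 ≤ D s ω := (ae_ball_iff (Set.to_countable _)).2 hD.nonneg
  have h2 : ∀ᵐ ω ∂Q, ∀ t : ℕ, ((t + 1 : ℕ) : ℕ∞) ∈ 𝕋.times → D (t + 1 : ℕ) ω ≤ D t ω := by
    simp only [ae_all_iff]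
    exact hD.antitone
  have h3 : ∀ᵐ ω ∂Q, 𝕋 = nat → Tendsto (fun n : ℕ => D n ω) atTop (𝓝 0) := by
    rw [ae_all_iff]
    exact hD.limit_nat
  have h4 : ∀ᵐ ω ∂Q, 𝕋 = natTop → Tendsto (fun n : ℕ => D n ω) atTop (𝓝 (D ⊤ ω)) := by
    rw [ae_all_iff]
    exact hD.limit_natTop
  filter_upwards [h1, h2, h3, h4, hD.start] with ω h1 h2 h3 h4 h5
  have h0 : ∀ s ∈ 𝕋.times, 0 ≤ optionalMeasure 𝕋 D s ω := by
    intro s hs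
    by_cases hst : s = ⊤
    · subst hst
      rw [optionalMeasure_top]
      exact h1 _ hs
    · lift s to ℕ using hst
      rw [optionalMeasure_coe]
      split_ifs with h
      · exact sub_nonneg.2 (h2 s h)
      · simpa using h1 _ hs
  refine ⟨h0, fun t ht => ⟨⟨h1 t ht, ?_⟩, hasSum_optionalMeasure h0 h3 h4 ht⟩⟩
  induction t with
  | zero => exact h5.le
  | succ k ih => exact (h2 k ht).trans (ih (mem_times_of_le k.le_succ ht))

theorem IsDiscounting.stronglyMeasurable (hD : IsDiscounting P Q ℱ 𝕋 D) {t : ℕ}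
    (ht : (t : ℕ∞) ∈ 𝕋.times) : StronglyMeasurable[ℱ t] (D t) := by
  cases t with
  | zero => exact hD.measurable_zero
  | succ k => exact (hD.measurable_succ k ht).mono (ℱ.mono k.le_succ)

theorem IsDiscounting.stronglyMeasurable_optionalMeasure (hD : IsDiscounting P Q ℱ 𝕋 D) {s : ℕ∞}
    (hs : s ∈ 𝕋.times) : StronglyMeasurable[mΩ] (optionalMeasure 𝕋 D s) := by
  classical
  by_cases hst : s = ⊤
  · subst hst
    have : optionalMeasure 𝕋 D ⊤ = D ⊤ := funext optionalMeasure_top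
    rw [this]
    exact (hD.measurable_top hs).mono (sigmaAt_le _)
  · lift s to ℕ using hst
    have h1 := (hD.stronglyMeasurable hs).mono (ℱ.le s)
    by_cases h : ((s + 1 : ℕ) : ℕ∞) ∈ 𝕋.times
    · have : optionalMeasure 𝕋 D s = D s - D (s + 1 : ℕ) := by
        funext ω
        simp only [optionalMeasure_coe, if_pos h, Pi.sub_apply]
      rw [this]
      exact h1.sub ((hD.stronglyMeasurable h).mono (ℱ.le _))
    · have : optionalMeasure 𝕋 D s = D s := by
        funext ω
        simp only [optionalMeasure_coe, if_neg h, sub_zero]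
      rwa [this]

/-- A `P`-a.s. bound transfers to `Q` at finite times. At infinity it can fail only where `M_∞ = ∞`,
and there the mass `D_∞` vanishes, so the weighted bound survives. -/
theorem IsDiscounting.ae_abs_optionalMeasure_mul_le [IsFiniteMeasure P] [IsFiniteMeasure Q]
    (hD : IsDiscounting P Q ℱ 𝕋 D) (hQ : LocallyAbsolutelyContinuous P Q ℱ 𝕋) {X : RealProcess Ω}
    (hX : X ∈ Rinfty P ℱ 𝕋) : ∃ C : ℝ, 0 ≤ C ∧ ∀ᵐ ω ∂Q,
      (∀ t : ℕ, (t : ℕ∞) ∈ 𝕋.times → |X t ω| ≤ C) ∧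
      ∀ s ∈ 𝕋.times, |optionalMeasure 𝕋 D s ω * X s ω| ≤ optionalMeasure 𝕋 D s ω * C := by
  obtain ⟨C, hC⟩ := hX.2
  have h1 : ∀ᵐ ω ∂Q, ∀ t : ℕ, (t : ℕ∞) ∈ 𝕋.times → |X t ω| ≤ C := by
    simp only [ae_all_iff]
    exact fun t ht => hQ.ae_bound_of_Linfty ht (Rinfty.stronglyMeasurable_coe hX ht)
      (hC.mono fun ω h => h t ht)
  have h2 : ∀ᵐ ω ∂Q, ⊤ ∈ 𝕋.times → D ⊤ ω ≠ 0 → |X ⊤ ω| ≤ C := by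
    rw [ae_all_iff]
    intro htop
    have h𝕋 := eq_natTop_of_top_mem htop
    have hmeas : MeasurableSet[⨆ n, ℱ n] {ω | |X ⊤ ω| ≤ C}ᶜ := by
      have h3 : StronglyMeasurable[⨆ n, ℱ n] (X ⊤) :=
        (hX.1 ⊤ htop).mono (iSup₂_le fun n _ => le_iSup ℱ n)
      exact (measurableSet_le (continuous_abs.measurable.comp h3.measurable)
        measurable_const).compl
    have h4 := ae_densityLimit_eq_top (P := P) (Q := Q)
      (fun n => hQ n (h𝕋 ▸ Set.mem_univ _)) hmeas (hC.mono fun ω h => h ⊤ htop)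
    filter_upwards [h4, hD.singular_natTop h𝕋] with ω h5 h6 h7
    by_contra h8
    exact h7 (h6 (h5 h8))
  refine ⟨max C 0, le_max_right _ _, ?_⟩
  filter_upwards [h1, h2, hD.ae_optionalMeasure] with ω h1 h2 h3
  refine ⟨fun t ht => (h1 t ht).trans (le_max_left _ _), fun s hs => ?_⟩
  rw [abs_mul, abs_of_nonneg (h3.1 s hs)]
  by_cases hst : s = ⊤
  · subst hst
    rw [optionalMeasure_top]
    by_cases h0 : D ⊤ ω = 0
    · simp [h0]
    · have h4 := h3.1 ⊤ hs
      rw [optionalMeasure_top] at h4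
      exact mul_le_mul_of_nonneg_left ((h2 hs h0).trans (le_max_left _ _)) h4
  · lift s to ℕ using hst
    exact mul_le_mul_of_nonneg_left ((h1 s hs).trans (le_max_left _ _)) (h3.1 s hs)

end Models

/-! ### Discounted payments and the one-step identity for penalties. -/

section Pairing

open Horizon

variable {Ω : Type*} {mΩ : MeasurableSpace Ω} {P Q : Measure Ω} {ℱ : Filtration ℕ mΩ}
  {𝕋 : Horizon} {D : RealProcess Ω} {ρ : ℕ → RealProcess Ω → Ω → ℝ}

/-- The cumulated payment `∑_{s ∈ 𝕋_t} γ_s X_s`. -/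
noncomputable def pairing (𝕋 : Horizon) (D X : RealProcess Ω) (t : ℕ) (ω : Ω) : ℝ :=
  ∑' s : 𝕋.timesFrom t, optionalMeasure 𝕋 D s ω * X s ω

/-- The one-step payment `γ_t X_t + D_{t+1} X_{t+1}`. -/
noncomputable def pairingStep (𝕋 : Horizon) (D X : RealProcess Ω) (t : ℕ) (ω : Ω) : ℝ :=
  optionalMeasure 𝕋 D t ω * X t ω + D (t + 1 : ℕ) ω * X (t + 1 : ℕ) ω

theorem summable_of_abs_le {ω : Ω} {X : RealProcess Ω} {C : ℝ} {t : ℕ}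
    (hs : HasSum (fun s : 𝕋.timesFrom t => optionalMeasure 𝕋 D s ω) (D t ω))
    (hC : ∀ s ∈ 𝕋.times, |optionalMeasure 𝕋 D s ω * X s ω| ≤ optionalMeasure 𝕋 D s ω * C) :
    Summable (fun s : 𝕋.timesFrom t => optionalMeasure 𝕋 D s ω * X s ω) :=
  Summable.of_norm_bounded (hs.summable.mul_right C) fun s => hC s s.2.1

theorem integrable_of_abs_le_mul [IsFiniteMeasure Q] (hD : IsDiscounting P Q ℱ 𝕋 D) {f : Ω → ℝ}
    (hf : AEStronglyMeasurable[mΩ] f Q) {t : ℕ} (ht : (t : ℕ∞) ∈ 𝕋.times) {C : ℝ} (hC0 : 0 ≤ C)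
    (hC : ∀ᵐ ω ∂Q, |f ω| ≤ C * D t ω) : Integrable f Q := by
  refine Integrable.of_bound hf C ?_
  filter_upwards [hC, hD.ae_optionalMeasure] with ω h1 h2
  exact h1.trans (mul_le_of_le_one_right hC0 (h2.2 t ht).1.2)

theorem timesFrom_eq_insert {t : ℕ} (ht : (t : ℕ∞) ∈ 𝕋.times) :
    𝕋.timesFrom t = {(t : ℕ∞)} ∪ 𝕋.timesFrom (t + 1 : ℕ) := by
  ext s
  constructor
  · rintro ⟨hs, h⟩
    rcases h.eq_or_lt with h | h
    · exact Or.inl h.symm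
    · exact Or.inr ⟨hs, succ_le_of_lt h⟩
  · rintro (h | ⟨hs, h⟩)
    · obtain rfl : s = t := h
      exact ⟨ht, le_rfl⟩
    · exact ⟨hs, (coe_lt_succ t).le.trans h⟩

/-- Multiplication by `d > 0` preserves order; where `d = 0` all members of `S` vanish, as does `0 ·
∞`. This serves `α_t`, where `1 / D_t` stands inside the conditional expectation. -/
theorem IsFamilyEssSup.const_mul_ite {m : MeasurableSpace Ω} {S S' : Set (Ω → ℝ)}
    {E : Ω → EReal} {d : Ω → ℝ} (hd : Measurable[m] d) (hd0 : ∀ᵐ ω ∂Q, 0 ≤ d ω)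
    (hE : IsFamilyEssSup Q m S' E) (hne : S.Nonempty)
    (h : ∀ f ∈ S, ∃ g ∈ S', f =ᵐ[Q] d * g) (h' : ∀ g ∈ S', ∃ f ∈ S, f =ᵐ[Q] d * g) :
    IsFamilyEssSup Q m S fun ω => (d ω : EReal) * if d ω = 0 then ⊤ else E ω := by
  classical
  refine ⟨?_, fun f hf => ?_, fun Z hZ => ?_⟩
  · refine (measurable_coe_real_ereal.comp hd).mul (Measurable.ite ?_ measurable_const hE.1)
    exact hd (measurableSet_singleton 0)
  · obtain ⟨g, hg, hfg⟩ := h f hf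
    filter_upwards [hfg, hE.2.1 g hg, hd0] with ω h1 h2 h3
    rw [h1, Pi.mul_apply]
    by_cases h0 : d ω = 0
    · simp [h0]
    · rw [if_neg h0, EReal.coe_mul]
      exact mul_le_mul_of_nonneg_left h2 (EReal.coe_nonneg.2 h3)
  · obtain ⟨f₀, hf₀⟩ := hne
    obtain ⟨g₀, -, hfg₀⟩ := h f₀ hf₀
    -- The bound for `S` is divided by `d`; the value `⊤` makes the competitor harmless where `d =
    -- 0`.
    have h1 := hE.2.2 (fun ω => if d ω = 0 then ⊤ else (((d ω)⁻¹ : ℝ) : EReal) * Z ω) fun g hg => by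
      obtain ⟨f, hf, hfg⟩ := h' g hg
      filter_upwards [hfg, hZ f hf, hd0] with ω h1 h2 h3
      by_cases h0 : d ω = 0
      · simp [h0]
      · rw [if_neg h0]
        refine le_trans (le_of_eq ?_)
          (mul_le_mul_of_nonneg_left h2 (EReal.coe_nonneg.2 (inv_nonneg.2 h3)))
        rw [h1, ← EReal.coe_mul, Pi.mul_apply, inv_mul_cancel_left₀ h0]
    filter_upwards [h1, hd0, hfg₀, hZ f₀ hf₀] with ω h2 h3 h4 h5
    by_cases h0 : d ω = 0
    · simpa [h4, h0] using h5
    · rw [if_neg h0] at h2 ⊢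
      refine (mul_le_mul_of_nonneg_left h2 (EReal.coe_nonneg.2 h3)).trans (le_of_eq ?_)
      rw [← mul_assoc, ← EReal.coe_mul, mul_inv_cancel₀ h0, EReal.coe_one, one_mul]

/-- Counterpart for `α_{t,t+1}`, where `1 / D_t` stands outside the supremum: the factors cancel
where `d ≠ 0`, and elsewhere members of `S` vanish by assumption. -/
theorem IsFamilyEssSup.const_mul_inv_ite {m : MeasurableSpace Ω} {S : Set (Ω → ℝ)}
    {E : Ω → EReal} {d : Ω → ℝ} (hd : Measurable[m] d)
    (hE : IsFamilyEssSup Q m S E) (hne : S.Nonempty)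
    (h : ∀ f ∈ S, ∀ᵐ ω ∂Q, d ω = 0 → f ω = 0) :
    IsFamilyEssSup Q m S
      fun ω => (d ω : EReal) * if d ω = 0 then ⊤ else (((d ω)⁻¹ : ℝ) : EReal) * E ω := by
  classical
  have he : (fun ω => (d ω : EReal) * if d ω = 0 then ⊤ else (((d ω)⁻¹ : ℝ) : EReal) * E ω) =
      fun ω => if d ω = 0 then 0 else E ω := by
    funext ω
    by_cases h0 : d ω = 0
    · simp [h0]
    · rw [if_neg h0, if_neg h0, ← mul_assoc, ← EReal.coe_mul, mul_inv_cancel₀ h0, EReal.coe_one,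
        one_mul]
  rw [he]
  refine ⟨?_, fun f hf => ?_, fun Z hZ => ?_⟩
  · exact Measurable.ite (hd (measurableSet_singleton 0)) measurable_const hE.1
  · filter_upwards [h f hf, hE.2.1 f hf] with ω h1 h2
    by_cases h0 : d ω = 0
    · simp [h0, h1 h0]
    · rwa [if_neg h0]
  · obtain ⟨f₀, hf₀⟩ := hne
    filter_upwards [hE.2.2 Z hZ, h f₀ hf₀, hZ f₀ hf₀] with ω h1 h2 h3
    by_cases h0 : d ω = 0
    · simpa [h0, h2 h0] using h3
    · rwa [if_neg h0]

theorem mem_Rinfty_of_mem_acceptanceSet {t : ℕ} (ht : (t : ℕ∞) ∈ 𝕋.times) {X : RealProcess Ω}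
    (hX : X ∈ acceptanceSet P ℱ 𝕋 ρ t) : X ∈ Rinfty P ℱ 𝕋 :=
  ((mem_RinftyFrom_iff ht).1 hX.1).1

theorem mem_Rinfty_of_mem_acceptanceSetStep {t : ℕ} (ht : ((t + 1 : ℕ) : ℕ∞) ∈ 𝕋.times)
    {X : RealProcess Ω} (hX : X ∈ acceptanceSetStep P ℱ 𝕋 ρ t) : X ∈ Rinfty P ℱ 𝕋 :=
  ((mem_RinftyBetween_iff (coe_lt_succ t).le (Or.inl ht)).1 hX.1).1

/-- The conditional expected losses of the acceptable positions at time `t`. -/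
def lossSet (P : Measure Ω) (ℱ : Filtration ℕ mΩ) (𝕋 : Horizon)
    (ρ : ℕ → RealProcess Ω → Ω → ℝ) (Q : Measure Ω) (D : RealProcess Ω) (t : ℕ) : Set (Ω → ℝ) :=
  {f | ∃ X ∈ acceptanceSet P ℱ 𝕋 ρ t, f = Q[-pairing 𝕋 D X t | ℱ t]}

/-- The conditional expected losses of the acceptable one-step positions at time `t`. -/
def lossSetStep (P : Measure Ω) (ℱ : Filtration ℕ mΩ) (𝕋 : Horizon)
    (ρ : ℕ → RealProcess Ω → Ω → ℝ) (Q : Measure Ω) (D : RealProcess Ω) (t : ℕ) : Set (Ω → ℝ) :=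
  {f | ∃ X ∈ acceptanceSetStep P ℱ 𝕋 ρ t, f = Q[-pairingStep 𝕋 D X t | ℱ t]}

theorem zero_mem_lossSet (hρ : IsDynamicConvexRisk P ℱ 𝕋 ρ) {t : ℕ} (ht : (t : ℕ∞) ∈ 𝕋.times) :
    0 ∈ lossSet P ℱ 𝕋 ρ Q D t := by
  refine ⟨0, zero_mem_acceptanceSet hρ ht, ?_⟩
  have : -pairing 𝕋 D (0 : RealProcess Ω) t = 0 := by funext ω; simp [pairing]
  rw [this, condExp_zero]

theorem zero_mem_lossSetStep (hρ : IsDynamicConvexRisk P ℱ 𝕋 ρ) {t : ℕ}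
    (ht : (t : ℕ∞) ∈ 𝕋.times) : 0 ∈ lossSetStep P ℱ 𝕋 ρ Q D t := by
  refine ⟨0, zero_mem_acceptanceSetStep hρ ht, ?_⟩
  have : -pairingStep 𝕋 D (0 : RealProcess Ω) t = 0 := by funext ω; simp [pairingStep]
  rw [this, condExp_zero]

theorem integrable_of_mem_lossSet {t : ℕ} {f : Ω → ℝ} (hf : f ∈ lossSet P ℱ 𝕋 ρ Q D t) :
    Integrable f Q := by
  obtain ⟨X, -, rfl⟩ := hf
  exact integrable_condExp

variable [IsFiniteMeasure P] [IsFiniteMeasure Q]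

theorem ae_summable_pairing (hD : IsDiscounting P Q ℱ 𝕋 D)
    (hQ : LocallyAbsolutelyContinuous P Q ℱ 𝕋) {X : RealProcess Ω} (hX : X ∈ Rinfty P ℱ 𝕋) :
    ∀ᵐ ω ∂Q, ∀ t : ℕ, (t : ℕ∞) ∈ 𝕋.times →
      Summable (fun s : 𝕋.timesFrom t => optionalMeasure 𝕋 D s ω * X s ω) := by
  obtain ⟨C, -, hC⟩ := hD.ae_abs_optionalMeasure_mul_le hQ hX
  filter_upwards [hC, hD.ae_optionalMeasure] with ω h1 h2 t ht
  exact summable_of_abs_le (h2.2 t ht).2 h1.2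

theorem exists_ae_abs_pairing_le (hD : IsDiscounting P Q ℱ 𝕋 D)
    (hQ : LocallyAbsolutelyContinuous P Q ℱ 𝕋) {X : RealProcess Ω} (hX : X ∈ Rinfty P ℱ 𝕋) :
    ∃ C : ℝ, 0 ≤ C ∧ ∀ᵐ ω ∂Q, ∀ t : ℕ, (t : ℕ∞) ∈ 𝕋.times →
      |pairing 𝕋 D X t ω| ≤ C * D t ω := by
  obtain ⟨C, hC0, hC⟩ := hD.ae_abs_optionalMeasure_mul_le hQ hX
  refine ⟨C, hC0, ?_⟩
  filter_upwards [hC, hD.ae_optionalMeasure] with ω h1 h2 t ht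
  have h3 := (h2.2 t ht).2.mul_right C
  have h4 := tsum_of_norm_bounded h3 (f := fun s : 𝕋.timesFrom t =>
    optionalMeasure 𝕋 D s ω * X s ω) fun s => h1.2 s s.2.1
  rw [mul_comm]
  exact h4

theorem exists_ae_abs_pairingStep_le (hD : IsDiscounting P Q ℱ 𝕋 D)
    (hQ : LocallyAbsolutelyContinuous P Q ℱ 𝕋) {X : RealProcess Ω} (hX : X ∈ Rinfty P ℱ 𝕋)
    {t : ℕ} (ht : ((t + 1 : ℕ) : ℕ∞) ∈ 𝕋.times) :
    ∃ C : ℝ, 0 ≤ C ∧ ∀ᵐ ω ∂Q, |pairingStep 𝕋 D X t ω| ≤ C * D t ω := by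
  obtain ⟨C, hC0, hC⟩ := hD.ae_abs_optionalMeasure_mul_le hQ hX
  refine ⟨C, hC0, ?_⟩
  have ht' := mem_times_of_le t.le_succ ht
  filter_upwards [hC, hD.ae_optionalMeasure] with ω h1 h2
  have h3 := h1.2 t ht'
  have h4 := mul_le_mul_of_nonneg_left (h1.1 _ ht) (h2.2 _ ht).1.1
  refine (abs_add_le _ _).trans ?_
  rw [abs_mul (D _ ω), abs_of_nonneg (h2.2 _ ht).1.1]
  rw [optionalMeasure_of_succ_mem ht] at h3 ⊢
  linarith

theorem aestronglyMeasurable_pairing (hD : IsDiscounting P Q ℱ 𝕋 D)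
    (hQ : LocallyAbsolutelyContinuous P Q ℱ 𝕋) {X : RealProcess Ω} (hX : X ∈ Rinfty P ℱ 𝕋)
    {t : ℕ} (ht : (t : ℕ∞) ∈ 𝕋.times) : AEStronglyMeasurable[mΩ] (pairing 𝕋 D X t) Q := by
  refine aestronglyMeasurable_of_tendsto_ae (u := (atTop : Filter (Finset (𝕋.timesFrom t))))
    (f := fun F ω => ∑ s ∈ F, optionalMeasure 𝕋 D s ω * X s ω) (fun F => ?_) ?_
  · refine (Finset.stronglyMeasurable_fun_sum F fun s _ => ?_).aestronglyMeasurable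
    exact (hD.stronglyMeasurable_optionalMeasure s.2.1).mul ((hX.1 s s.2.1).mono (sigmaAt_le _))
  · filter_upwards [ae_summable_pairing hD hQ hX] with ω h
    exact (h t ht).hasSum

theorem integrable_pairing (hD : IsDiscounting P Q ℱ 𝕋 D)
    (hQ : LocallyAbsolutelyContinuous P Q ℱ 𝕋) {X : RealProcess Ω} (hX : X ∈ Rinfty P ℱ 𝕋)
    {t : ℕ} (ht : (t : ℕ∞) ∈ 𝕋.times) : Integrable (pairing 𝕋 D X t) Q := by
  obtain ⟨C, hC0, hC⟩ := exists_ae_abs_pairing_le hD hQ hX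
  exact integrable_of_abs_le_mul hD (aestronglyMeasurable_pairing hD hQ hX ht) ht hC0
    (hC.mono fun ω h => h t ht)

theorem integrable_pairingStep (hD : IsDiscounting P Q ℱ 𝕋 D)
    (hQ : LocallyAbsolutelyContinuous P Q ℱ 𝕋) {X : RealProcess Ω} (hX : X ∈ Rinfty P ℱ 𝕋)
    {t : ℕ} (ht : ((t + 1 : ℕ) : ℕ∞) ∈ 𝕋.times) : Integrable (pairingStep 𝕋 D X t) Q := by
  obtain ⟨C, hC0, hC⟩ := exists_ae_abs_pairingStep_le hD hQ hX ht
  have ht' := mem_times_of_le t.le_succ ht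
  refine integrable_of_abs_le_mul hD ?_ ht' hC0 hC
  exact (((hD.stronglyMeasurable_optionalMeasure ht').mul
    ((hX.1 _ ht').mono (sigmaAt_le _))).add (((hD.stronglyMeasurable ht).mono (ℱ.le _)).mul
    ((hX.1 _ ht).mono (sigmaAt_le _)))).aestronglyMeasurable

/-- The payments of a one-step position plus a position starting at `t + 1`. -/
theorem ae_pairing_add_eq (hD : IsDiscounting P Q ℱ 𝕋 D)
    (hQ : LocallyAbsolutelyContinuous P Q ℱ 𝕋) {t : ℕ} (ht : ((t + 1 : ℕ) : ℕ∞) ∈ 𝕋.times)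
    {Y Z : RealProcess Ω} (hY : Y ∈ Rinfty P ℱ 𝕋) (hZ : Z ∈ Rinfty P ℱ 𝕋)
    (hYt : ∀ r, ((t + 1 : ℕ) : ℕ∞) ≤ r → Y r = Y (t + 1 : ℕ)) (hZt : Z t = 0) :
    pairing 𝕋 D (Y + Z) t =ᵐ[Q] pairingStep 𝕋 D Y t + pairing 𝕋 D Z (t + 1) := by
  have ht' := mem_times_of_le t.le_succ ht
  filter_upwards [ae_summable_pairing hD hQ (Rinfty.add_mem hY hZ), ae_summable_pairing hD hQ hY,
    ae_summable_pairing hD hQ hZ, hD.ae_optionalMeasure] with ω h1 h2 h3 h4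
  have hdisj : Disjoint {(t : ℕ∞)} (𝕋.timesFrom (t + 1 : ℕ)) := by
    rw [Set.disjoint_singleton_left]
    exact fun h => (coe_lt_succ t).not_ge h.2
  have h5 : pairing 𝕋 D (Y + Z) t ω = optionalMeasure 𝕋 D t ω * Y t ω +
      ∑' s : 𝕋.timesFrom (t + 1 : ℕ), optionalMeasure 𝕋 D s ω * (Y + Z) s ω := by
    rw [pairing, timesFrom_eq_insert ht', Summable.tsum_union_disjoint
      (f := fun s => optionalMeasure 𝕋 D s ω * (Y + Z) s ω) hdisj
      (Set.finite_singleton _ |>.summable _) (h1 _ ht)]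
    congr 1
    rw [tsum_singleton (t : ℕ∞) fun s => optionalMeasure 𝕋 D s ω * (Y + Z) s ω]
    simp [hZt]
  -- `Y` is constant from `t + 1` on, and the masses there add up to `D_{t+1}`.
  have h6 : ∑' s : 𝕋.timesFrom (t + 1 : ℕ), optionalMeasure 𝕋 D s ω * Y s ω =
      D (t + 1 : ℕ) ω * Y (t + 1 : ℕ) ω := by
    rw [← ((h4.2 _ ht).2.mul_right (Y (t + 1 : ℕ) ω)).tsum_eq]
    exact tsum_congr fun s => by rw [hYt s s.2.2]
  have h7 := (h2 _ ht).tsum_add (h3 _ ht)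
  rw [h5, Pi.add_apply, pairingStep, pairing, ← h6, add_assoc, ← h7]
  congr 1
  exact tsum_congr fun s => by rw [Pi.add_apply, Pi.add_apply, mul_add]

theorem ae_pairing_pasting (hD : IsDiscounting P Q ℱ 𝕋 D)
    (hQ : LocallyAbsolutelyContinuous P Q ℱ 𝕋) {t : ℕ} (ht : (t : ℕ∞) ∈ 𝕋.times)
    {X Y : RealProcess Ω} (hX : X ∈ Rinfty P ℱ 𝕋) (hY : Y ∈ Rinfty P ℱ 𝕋) (l : Ω → ℝ) :
    pairing 𝕋 D (fun s ω => l ω * X s ω + (1 - l ω) * Y s ω) t =ᵐ[Q]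
      fun ω => l ω * pairing 𝕋 D X t ω + (1 - l ω) * pairing 𝕋 D Y t ω := by
  filter_upwards [ae_summable_pairing hD hQ hX, ae_summable_pairing hD hQ hY] with ω h1 h2
  rw [pairing, pairing, pairing, ← tsum_mul_left, ← tsum_mul_left,
    ← ((h1 t ht).mul_left _).tsum_add ((h2 t ht).mul_left _)]
  exact tsum_congr fun s => by ring

/-! ### The discounted penalties as essential suprema -/

theorem isFamilyEssSup_discPenalty (hρ : IsDynamicConvexRisk P ℱ 𝕋 ρ)
    (hQ : LocallyAbsolutelyContinuous P Q ℱ 𝕋) (hD : IsDiscounting P Q ℱ 𝕋 D) {t : ℕ}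
    (ht : (t : ℕ∞) ∈ 𝕋.times) :
    IsFamilyEssSup Q (ℱ t) (lossSet P ℱ 𝕋 ρ Q D t) (discPenalty P ℱ 𝕋 ρ Q D t) := by
  have hDm := hD.stronglyMeasurable ht
  have key : ∀ X ∈ acceptanceSet P ℱ 𝕋 ρ t, Q[-pairing 𝕋 D X t | ℱ t] =ᵐ[Q]
      D t * Q[fun ω' => -∑' s : 𝕋.timesFrom t, optionalMeasure 𝕋 D s ω' / D t ω' * X s ω' | ℱ t] := by
    intro X hX
    have hXR := mem_Rinfty_of_mem_acceptanceSet ht hX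
    obtain ⟨C, hC0, hC⟩ := exists_ae_abs_pairing_le hD hQ hXR
    let h : Ω → ℝ := fun ω => -((D t ω)⁻¹ * pairing 𝕋 D X t ω)
    have he : (fun ω' => -∑' s : 𝕋.timesFrom t, optionalMeasure 𝕋 D s ω' / D t ω' * X s ω') = h := by
      funext ω
      simp only [h, pairing, ← tsum_mul_left]
      congr 1
      exact tsum_congr fun s => by ring
    rw [he]
    -- Where `D_t = 0` the payment vanishes, being bounded by `C D_t`, so dividing and multiplying
    -- back is harmless.
    have h1 : -pairing 𝕋 D X t =ᵐ[Q] D t * h := by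
      filter_upwards [hC] with ω h1
      by_cases h0 : D t ω = 0
      · have h2 := h1 t ht
        rw [h0, mul_zero] at h2
        simp [h0, abs_nonpos_iff.1 h2]
      · simp [h, mul_inv_cancel_left₀ h0]
    have hhm : AEStronglyMeasurable[mΩ] h Q :=
      (((hDm.mono (ℱ.le t)).measurable.inv.stronglyMeasurable.aestronglyMeasurable).mul
        (aestronglyMeasurable_pairing hD hQ hXR ht)).neg
    have hint : Integrable h Q := by
      refine Integrable.of_bound hhm C ?_
      filter_upwards [hC, hD.ae_optionalMeasure] with ω h1 h2
      have h3 := (h2.2 t ht).1.1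
      rw [Real.norm_eq_abs, abs_neg, abs_mul, abs_of_nonneg (inv_nonneg.2 h3)]
      by_cases h0 : D t ω = 0
      · simpa [h0] using hC0
      · rw [inv_mul_le_iff₀ (lt_of_le_of_ne h3 (Ne.symm h0)), mul_comm]
        exact h1 t ht
    refine (condExp_congr_ae h1).trans (condExp_mul_of_stronglyMeasurable_left hDm ?_ hint)
    exact (integrable_pairing hD hQ hXR ht).neg.congr h1
  refine IsFamilyEssSup.const_mul_ite hDm.measurable
    (hD.ae_optionalMeasure.mono fun ω h => (h.2 t ht).1.1)
    (isFamilyEssSup_familyEssSup Q (ℱ.le t) ?_) ⟨0, zero_mem_lossSet hρ ht⟩ ?_ ?_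
  · rintro f ⟨X, -, rfl⟩
    exact stronglyMeasurable_condExp.measurable
  · rintro f ⟨X, hX, rfl⟩
    exact ⟨_, ⟨X, hX, rfl⟩, key X hX⟩
  · rintro f ⟨X, hX, rfl⟩
    exact ⟨_, ⟨X, hX, rfl⟩, key X hX⟩

theorem isFamilyEssSup_discPenaltyStep (hρ : IsDynamicConvexRisk P ℱ 𝕋 ρ)
    (hQ : LocallyAbsolutelyContinuous P Q ℱ 𝕋) (hD : IsDiscounting P Q ℱ 𝕋 D) {t : ℕ}
    (ht : ((t + 1 : ℕ) : ℕ∞) ∈ 𝕋.times) :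
    IsFamilyEssSup Q (ℱ t) (lossSetStep P ℱ 𝕋 ρ Q D t) (discPenaltyStep P ℱ 𝕋 ρ Q D t) := by
  have ht' := mem_times_of_le t.le_succ ht
  have hDm := hD.stronglyMeasurable ht'
  have hset : {f | ∃ X ∈ acceptanceSetStep P ℱ 𝕋 ρ t,
      f = Q[fun ω' => -(optionalMeasure 𝕋 D t ω' * X t ω')
        - D ((t + 1 : ℕ) : ℕ∞) ω' * X ((t + 1 : ℕ) : ℕ∞) ω' | ℱ t]} =
      lossSetStep P ℱ 𝕋 ρ Q D t := by
    have : ∀ X : RealProcess Ω, (fun ω' => -(optionalMeasure 𝕋 D t ω' * X t ω')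
        - D ((t + 1 : ℕ) : ℕ∞) ω' * X ((t + 1 : ℕ) : ℕ∞) ω') = -pairingStep 𝕋 D X t := by
      intro X
      funext ω
      simp only [pairingStep, Pi.neg_apply]
      ring
    simp only [this, lossSetStep]
  have hE := isFamilyEssSup_familyEssSup Q (ℱ.le t) (S := lossSetStep P ℱ 𝕋 ρ Q D t) (by
    rintro f ⟨X, -, rfl⟩
    exact stronglyMeasurable_condExp.measurable)
  have h := hE.const_mul_inv_ite hDm.measurable ⟨0, zero_mem_lossSetStep hρ ht'⟩ ?_
  · have he : discPenaltyStep P ℱ 𝕋 ρ Q D t = fun ω => (D t ω : EReal) *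
        if D t ω = 0 then ⊤ else (((D t ω)⁻¹ : ℝ) : EReal) *
          familyEssSup Q (ℱ t) (lossSetStep P ℱ 𝕋 ρ Q D t) ω := by
      funext ω
      rw [discPenaltyStep, penaltyStep, hset]
    rw [he]
    exact h
  · rintro f ⟨X, hX, rfl⟩
    have hXR := mem_Rinfty_of_mem_acceptanceSetStep ht hX
    obtain ⟨C, hC0, hC⟩ := exists_ae_abs_pairingStep_le hD hQ hXR ht
    have hDint : Integrable (fun ω => C * D t ω) Q := by
      refine integrable_of_abs_le_mul hD (t := t) (C := C) ?_ ht' hC0 ?_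
      · exact ((hDm.mono (ℱ.le t)).const_mul C).aestronglyMeasurable
      · filter_upwards [hD.ae_optionalMeasure] with ω h
        rw [abs_of_nonneg (mul_nonneg hC0 (h.2 t ht').1.1)]
    have hi := (integrable_pairingStep hD hQ hXR ht).neg
    -- Squeezed between `-C D_t` and `C D_t`, both `ℱ t`-measurable, the conditional loss vanishes
    -- where `D_t = 0`.
    have h1 := condExp_mono (m := ℱ t) hi hDint (hC.mono fun ω h => (neg_le_abs _).trans h)
    have h2 := condExp_mono (m := ℱ t) hDint.neg hi
      (hC.mono fun ω h => neg_le_neg ((le_abs_self _).trans h))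
    rw [condExp_of_stronglyMeasurable (ℱ.le t) (hDm.const_mul C) hDint] at h1
    rw [condExp_of_stronglyMeasurable (ℱ.le t) (hDm.const_mul C).neg hDint.neg] at h2
    filter_upwards [h1, h2] with ω h1 h2 h0
    simp only [Pi.neg_apply, h0, mul_zero, neg_zero] at h1 h2
    exact le_antisymm h1 h2

theorem directed_lossSet (hρ : IsDynamicConvexRisk P ℱ 𝕋 ρ)
    (hQ : LocallyAbsolutelyContinuous P Q ℱ 𝕋) (hD : IsDiscounting P Q ℱ 𝕋 D) {t : ℕ}
    (ht : (t : ℕ∞) ∈ 𝕋.times) : ∀ f ∈ lossSet P ℱ 𝕋 ρ Q D t, ∀ g ∈ lossSet P ℱ 𝕋 ρ Q D t,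
      ∃ h ∈ lossSet P ℱ 𝕋 ρ Q D t, f ≤ᵐ[Q] h ∧ g ≤ᵐ[Q] h := by
  rintro _ ⟨X, hX, rfl⟩ _ ⟨Y, hY, rfl⟩
  have hXR := mem_Rinfty_of_mem_acceptanceSet ht hX
  have hYR := mem_Rinfty_of_mem_acceptanceSet ht hY
  -- Pasting along the event where the loss of `X` is the larger one yields the pointwise maximum of
  -- both losses.
  let A : Set Ω := {ω | (Q[-pairing 𝕋 D Y t | ℱ t]) ω ≤ (Q[-pairing 𝕋 D X t | ℱ t]) ω}
  have hA : MeasurableSet[ℱ t] A := measurableSet_le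
    stronglyMeasurable_condExp.measurable stronglyMeasurable_condExp.measurable
  let l : Ω → ℝ := A.indicator fun _ => 1
  have hl : StronglyMeasurable[ℱ t] l := stronglyMeasurable_const.indicator hA
  have hl01 : ∀ ω, 0 ≤ l ω ∧ l ω ≤ 1 := fun ω => by
    by_cases h : ω ∈ A <;> simp [l, h]
  refine ⟨_, ⟨_, pasting_mem_acceptanceSet hρ ht hX hY hl hl01, rfl⟩, ?_⟩
  have hXi := (integrable_pairing hD hQ hXR ht).neg
  have hYi := (integrable_pairing hD hQ hYR ht).neg
  have hl' : StronglyMeasurable[ℱ t] (1 - l) := stronglyMeasurable_const.sub hl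
  have hXl : Integrable (l * -pairing 𝕋 D X t) Q :=
    hXi.bdd_mul (c := 1) (hl.mono (ℱ.le t)).aestronglyMeasurable
      (Eventually.of_forall fun ω => by rw [Real.norm_of_nonneg (hl01 ω).1]; exact (hl01 ω).2)
  have hYl : Integrable ((1 - l) * -pairing 𝕋 D Y t) Q :=
    hYi.bdd_mul (c := 1) (hl'.mono (ℱ.le t)).aestronglyMeasurable
      (Eventually.of_forall fun ω => by
        have := hl01 ω
        rw [Real.norm_of_nonneg (by simp; linarith)]
        simp; linarith)
  have h1 : -pairing 𝕋 D (fun s ω => l ω * X s ω + (1 - l ω) * Y s ω) t =ᵐ[Q]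
      l * -pairing 𝕋 D X t + (1 - l) * -pairing 𝕋 D Y t := by
    filter_upwards [ae_pairing_pasting hD hQ ht hXR hYR l] with ω h
    simp only [Pi.neg_apply, Pi.add_apply, Pi.mul_apply, Pi.sub_apply, Pi.one_apply, h]
    ring
  have h2 : Q[-pairing 𝕋 D (fun s ω => l ω * X s ω + (1 - l ω) * Y s ω) t | ℱ t] =ᵐ[Q]
      l * Q[-pairing 𝕋 D X t | ℱ t] + (1 - l) * Q[-pairing 𝕋 D Y t | ℱ t] :=
    (condExp_congr_ae h1).trans ((condExp_add hXl hYl _).trans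
      ((condExp_mul_of_stronglyMeasurable_left hl hXl hXi).add
        (condExp_mul_of_stronglyMeasurable_left hl' hYl hYi)))
  have h3 : ∀ᵐ ω ∂Q, max ((Q[-pairing 𝕋 D X t | ℱ t]) ω) ((Q[-pairing 𝕋 D Y t | ℱ t]) ω) =
      (Q[-pairing 𝕋 D (fun s ω => l ω * X s ω + (1 - l ω) * Y s ω) t | ℱ t]) ω := by
    filter_upwards [h2] with ω h2
    rw [h2]
    by_cases h : ω ∈ A
    · have : l ω = 1 := Set.indicator_of_mem h _
      simp only [Pi.add_apply, Pi.mul_apply, Pi.sub_apply, Pi.one_apply, this]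
      rw [max_eq_left h]
      ring
    · have : l ω = 0 := Set.indicator_of_notMem h _
      simp only [Pi.add_apply, Pi.mul_apply, Pi.sub_apply, Pi.one_apply, this]
      rw [max_eq_right (not_le.1 h).le]
      ring
  exact ⟨h3.mono fun ω h => h ▸ le_max_left _ _, h3.mono fun ω h => h ▸ le_max_right _ _⟩

theorem condExp_pairing_add (hQ : LocallyAbsolutelyContinuous P Q ℱ 𝕋)
    (hD : IsDiscounting P Q ℱ 𝕋 D) {t : ℕ} (ht : ((t + 1 : ℕ) : ℕ∞) ∈ 𝕋.times)
    {Y Z : RealProcess Ω} (hY : Y ∈ acceptanceSetStep P ℱ 𝕋 ρ t)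
    (hZ : Z ∈ acceptanceSet P ℱ 𝕋 ρ (t + 1)) :
    Q[-pairing 𝕋 D (Y + Z) t | ℱ t] =ᵐ[Q]
      Q[-pairingStep 𝕋 D Y t | ℱ t] + Q[Q[-pairing 𝕋 D Z (t + 1) | ℱ (t + 1)] | ℱ t] := by
  obtain ⟨hYR, hYe⟩ := (mem_RinftyBetween_iff (coe_lt_succ t).le (Or.inl ht)).1 hY.1
  obtain ⟨hZR, hZe⟩ := (mem_RinftyFrom_iff ht).1 hZ.1
  have h1 := ae_pairing_add_eq hD hQ ht hYR hZR
    (fun r hr => by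
      rw [((proj_eq_self_iff.1 hYe) r).2 ((coe_lt_succ t).le.trans hr), min_eq_right hr])
    (((proj_eq_self_iff.1 hZe) t).1 (coe_lt_succ t))
  have h2 : -pairing 𝕋 D (Y + Z) t =ᵐ[Q] -pairingStep 𝕋 D Y t + -pairing 𝕋 D Z (t + 1) := by
    filter_upwards [h1] with ω h
    simp only [Pi.neg_apply, Pi.add_apply, h]
    ring
  refine (condExp_congr_ae h2).trans ((condExp_add (integrable_pairingStep hD hQ hYR ht).neg
    (integrable_pairing hD hQ hZR ht).neg _).trans (EventuallyEq.rfl.add ?_))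
  exact (condExp_condExp_of_le (ℱ.mono t.le_succ) (ℱ.le _)).symm

/-- One step of the Doob decomposition of the discounted penalty process. -/
theorem discPenalty_step (hρ : IsDynamicConvexRisk P ℱ 𝕋 ρ) (hcons : TimeConsistent P ℱ 𝕋 ρ)
    (hQ : LocallyAbsolutelyContinuous P Q ℱ 𝕋) (hD : IsDiscounting P Q ℱ 𝕋 D) {t : ℕ}
    (ht : ((t + 1 : ℕ) : ℕ∞) ∈ 𝕋.times)
    (hfin : ∀ᵐ ω ∂Q, discPenalty P ℱ 𝕋 ρ Q D t ω ≠ ⊤)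
    (hint : Integrable (fun ω => (discPenalty P ℱ 𝕋 ρ Q D t ω).toReal) Q) :
    (∀ᵐ ω ∂Q, discPenaltyStep P ℱ 𝕋 ρ Q D t ω ≠ ⊤) ∧
    (∀ᵐ ω ∂Q, discPenalty P ℱ 𝕋 ρ Q D (t + 1) ω ≠ ⊤) ∧
    Integrable (fun ω => (discPenalty P ℱ 𝕋 ρ Q D (t + 1) ω).toReal) Q ∧
    (fun ω => (discPenaltyStep P ℱ 𝕋 ρ Q D t ω).toReal) =ᵐ[Q]
      fun ω => (discPenalty P ℱ 𝕋 ρ Q D t ω).toReal -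
        (Q[fun ω' => (discPenalty P ℱ 𝕋 ρ Q D (t + 1) ω').toReal | ℱ t]) ω := by
  have ht' := mem_times_of_le t.le_succ ht
  refine (isFamilyEssSup_discPenalty hρ hQ hD ht').toReal_eq_sub_condExp (ℱ.le t) (ℱ.le (t + 1))
    (isFamilyEssSup_discPenaltyStep hρ hQ hD ht) (isFamilyEssSup_discPenalty hρ hQ hD ht)
    (zero_mem_lossSetStep hρ ht') (zero_mem_lossSet hρ ht) ?_
    (fun f hf => integrable_of_mem_lossSet hf) ?_ (directed_lossSet hρ hQ hD ht) ?_ ?_ hfin hint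
  · rintro f ⟨X, -, rfl⟩
    exact stronglyMeasurable_condExp.measurable.mono (ℱ.le _) le_rfl
  · rintro f ⟨X, -, rfl⟩
    exact integrable_condExp
  · rintro f ⟨X, hX, rfl⟩
    obtain ⟨Y, hY, Z, hZ, rfl⟩ := exists_add_of_mem_acceptanceSet hρ hcons ht hX
    exact ⟨_, ⟨Y, hY, rfl⟩, _, ⟨Z, hZ, rfl⟩, condExp_pairing_add hQ hD ht hY hZ⟩
  · rintro g ⟨Y, hY, rfl⟩ h ⟨Z, hZ, rfl⟩
    exact ⟨_, ⟨Y + Z, add_mem_acceptanceSet hρ hcons ht hY hZ, rfl⟩,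
      condExp_pairing_add hQ hD ht hY hZ⟩

end Pairing

/-! ### From one-step relations to martingales and supermartingales. -/

section Martingales

open Horizon

variable {Ω : Type*} {mΩ : MeasurableSpace Ω} {P Q : Measure Ω} {ℱ : Filtration ℕ mΩ}
  {𝕋 : Horizon} {D : RealProcess Ω} {ρ : ℕ → RealProcess Ω → Ω → ℝ}

/-- The one-step criterion for supermartingales on the finite time points. -/
theorem supermartingale_restrictTimes [IsFiniteMeasure Q] {f : ℕ → Ω → ℝ}
    (hm : ∀ t : ℕ, (t : ℕ∞) ∈ 𝕋.times → StronglyMeasurable[ℱ t] (f t))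
    (hint : ∀ t : ℕ, (t : ℕ∞) ∈ 𝕋.times → Integrable (f t) Q)
    (hstep : ∀ t : ℕ, ((t + 1 : ℕ) : ℕ∞) ∈ 𝕋.times → Q[f (t + 1) | ℱ t] ≤ᵐ[Q] f t) :
    Supermartingale (fun t : 𝕋.FiniteTimes => f t) (restrictTimes ℱ 𝕋) Q := by
  refine ⟨fun t => hm t t.2, fun s t hst => ?_, fun t => hint t t.2⟩
  obtain ⟨s, hs⟩ := s
  obtain ⟨t, ht⟩ := t
  have hst' : s ≤ t := hst
  clear hst
  change Q[f t | ℱ s] ≤ᵐ[Q] f s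
  induction t, hst' using Nat.le_induction with
  | base => rw [condExp_of_stronglyMeasurable (ℱ.le s) (hm s hs) (hint s hs)]
  | succ n hsn ih =>
    have hn := mem_times_of_le n.le_succ ht
    refine EventuallyLE.trans ?_ (ih hn)
    exact (condExp_condExp_of_le (ℱ.mono hsn) (ℱ.le n)).symm.le.trans
      (condExp_mono integrable_condExp (hint n hn) (hstep n ht))

/-- The one-step criterion for martingales on the finite time points. -/
theorem martingale_restrictTimes [IsFiniteMeasure Q] {f : ℕ → Ω → ℝ}
    (hm : ∀ t : ℕ, (t : ℕ∞) ∈ 𝕋.times → StronglyMeasurable[ℱ t] (f t))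
    (hint : ∀ t : ℕ, (t : ℕ∞) ∈ 𝕋.times → Integrable (f t) Q)
    (hstep : ∀ t : ℕ, ((t + 1 : ℕ) : ℕ∞) ∈ 𝕋.times → Q[f (t + 1) | ℱ t] =ᵐ[Q] f t) :
    Martingale (fun t : 𝕋.FiniteTimes => f t) (restrictTimes ℱ 𝕋) Q := by
  refine martingale_iff.2
    ⟨supermartingale_restrictTimes hm hint fun t ht => (hstep t ht).le, ?_⟩
  have h := (supermartingale_restrictTimes (Q := Q) (f := fun t => -f t)
    (fun t ht => (hm t ht).neg) (fun t ht => (hint t ht).neg) fun t ht => ?_).neg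
  · convert h using 1
    funext t
    simp
  · filter_upwards [condExp_neg (m := ℱ t) (μ := Q) (f (t + 1)), hstep t ht] with ω h1 h2
    rw [h1, Pi.neg_apply, Pi.neg_apply, h2]

/-- The real part of the risk process, for the position `X`. -/
noncomputable def riskPart (𝕋 : Horizon) (ρ : ℕ → RealProcess Ω → Ω → ℝ) (D X : RealProcess Ω)
    (t : ℕ) (ω : Ω) : ℝ :=
  D t ω * (risk 𝕋 ρ t X ω + X t ω) + ∑ s ∈ Finset.range (t + 1), D s ω * -(increment X s ω)

theorem stronglyMeasurable_increment {X : RealProcess Ω} (hX : X ∈ Rinfty P ℱ 𝕋) {s : ℕ}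
    (hs : (s : ℕ∞) ∈ 𝕋.times) : StronglyMeasurable[ℱ s] (increment X s) := by
  cases s with
  | zero => exact Rinfty.stronglyMeasurable_coe hX hs
  | succ k =>
    exact (Rinfty.stronglyMeasurable_coe hX hs).sub
      ((Rinfty.stronglyMeasurable_coe hX (mem_times_of_le k.le_succ hs)).mono (ℱ.mono k.le_succ))

theorem stronglyMeasurable_sum_increment (hD : IsDiscounting P Q ℱ 𝕋 D) {X : RealProcess Ω}
    (hX : X ∈ Rinfty P ℱ 𝕋) {t : ℕ} (ht : (t : ℕ∞) ∈ 𝕋.times) :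
    StronglyMeasurable[ℱ t]
      fun ω => ∑ s ∈ Finset.range (t + 1), D s ω * -(increment X s ω) := by
  refine Finset.stronglyMeasurable_fun_sum _ fun s hs => ?_
  have hst : s ≤ t := Nat.lt_succ_iff.1 (Finset.mem_range.1 hs)
  have hs' := mem_times_of_le hst ht
  exact ((hD.stronglyMeasurable hs').mul (stronglyMeasurable_increment hX hs').neg).mono
    (ℱ.mono hst)

theorem stronglyMeasurable_riskPart (hρ : IsDynamicConvexRisk P ℱ 𝕋 ρ)
    (hD : IsDiscounting P Q ℱ 𝕋 D) {X : RealProcess Ω} (hX : X ∈ Rinfty P ℱ 𝕋) {t : ℕ}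
    (ht : (t : ℕ∞) ∈ 𝕋.times) : StronglyMeasurable[ℱ t] (riskPart 𝕋 ρ D X t) :=
  ((hD.stronglyMeasurable ht).mul ((risk_mem_Linfty hρ ht hX).1.add
    (Rinfty.stronglyMeasurable_coe hX ht))).add (stronglyMeasurable_sum_increment hD hX ht)

theorem ae_risk_sub_stepFrom (hρ : IsDynamicConvexRisk P ℱ 𝕋 ρ)
    (hQ : LocallyAbsolutelyContinuous P Q ℱ 𝕋) {X : RealProcess Ω} (hX : X ∈ Rinfty P ℱ 𝕋)
    {t : ℕ} (ht : (t : ℕ∞) ∈ 𝕋.times) :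
    StronglyMeasurable[ℱ t] (risk 𝕋 ρ t (X - stepFrom t (X t))) ∧
      ∀ᵐ ω ∂Q, risk 𝕋 ρ t (X - stepFrom t (X t)) ω = risk 𝕋 ρ t X ω + X t ω := by
  have hm := Linfty.neg_mem (Rinfty.apply_mem_Linfty hX ht)
  have he : X - stepFrom t (X t) = X + stepFrom t (-X t) := by
    rw [sub_eq_add_neg]
    congr 1
    funext r ω
    by_cases h : (t : ℕ∞) ≤ r <;> simp [stepFrom, h]
  rw [he]
  have h1 := (risk_mem_Linfty hρ ht (Rinfty.add_mem hX (Rinfty.stepFrom_mem hm))).1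
  refine ⟨h1, ?_⟩
  have h2 := (risk_mem_Linfty hρ ht hX).1.add (Rinfty.stronglyMeasurable_coe hX ht)
  refine hQ.ae_of_ae ht (s := {ω | risk 𝕋 ρ t (X + stepFrom t (-X t)) ω
    = risk 𝕋 ρ t X ω + X t ω}) (measurableSet_eq_fun h1.measurable h2.measurable) ?_
  filter_upwards [risk_add_stepFrom hρ ht hX hm] with ω h
  simp only [h, Pi.neg_apply, sub_neg_eq_add]

variable [IsProbabilityMeasure P] [IsProbabilityMeasure Q]

theorem discPenalty_finite_integrable (hℱ : ℱ 0 = ⊥) (hρ : IsDynamicConvexRisk P ℱ 𝕋 ρ)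
    (hcons : TimeConsistent P ℱ 𝕋 ρ) (hQ : LocallyAbsolutelyContinuous P Q ℱ 𝕋)
    (hD : IsDiscounting P Q ℱ 𝕋 D) (hα : ∀ᵐ ω ∂Q, penalty P ℱ 𝕋 ρ Q D 0 ω < ⊤) (t : ℕ)
    (ht : (t : ℕ∞) ∈ 𝕋.times) :
    (∀ᵐ ω ∂Q, discPenalty P ℱ 𝕋 ρ Q D t ω ≠ ⊤) ∧
      Integrable (fun ω => (discPenalty P ℱ 𝕋 ρ Q D t ω).toReal) Q := by
  induction t with
  | zero =>
    constructor
    · filter_upwards [hα, hD.start] with ω h1 h2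
      have h3 : D ((0 : ℕ) : ℕ∞) ω = 1 := h2
      rw [discPenalty, h3, EReal.coe_one, one_mul]
      exact h1.ne
    · have h1 : StronglyMeasurable[⊥] fun ω => (discPenalty P ℱ 𝕋 ρ Q D 0 ω).toReal := by
        rw [← hℱ]
        exact (measurable_ereal_toReal.comp
          (isFamilyEssSup_discPenalty hρ hQ hD ht).1).stronglyMeasurable
      obtain ⟨c, hc⟩ := stronglyMeasurable_bot_iff.1 h1
      rw [hc]
      exact integrable_const c
  | succ k ih =>
    obtain ⟨h1, h2⟩ := ih (mem_times_of_le k.le_succ ht)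
    obtain ⟨-, h3, h4, -⟩ := discPenalty_step hρ hcons hQ hD ht h1 h2
    exact ⟨h3, h4⟩

theorem discPenalty_nonneg (hρ : IsDynamicConvexRisk P ℱ 𝕋 ρ)
    (hQ : LocallyAbsolutelyContinuous P Q ℱ 𝕋) (hD : IsDiscounting P Q ℱ 𝕋 D) {t : ℕ}
    (ht : (t : ℕ∞) ∈ 𝕋.times) : ∀ᵐ ω ∂Q, 0 ≤ discPenalty P ℱ 𝕋 ρ Q D t ω :=
  (isFamilyEssSup_discPenalty hρ hQ hD ht).2.1 0 (zero_mem_lossSet hρ ht)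

theorem discPenaltyStep_nonneg (hρ : IsDynamicConvexRisk P ℱ 𝕋 ρ)
    (hQ : LocallyAbsolutelyContinuous P Q ℱ 𝕋) (hD : IsDiscounting P Q ℱ 𝕋 D) {t : ℕ}
    (ht : ((t + 1 : ℕ) : ℕ∞) ∈ 𝕋.times) : ∀ᵐ ω ∂Q, 0 ≤ discPenaltyStep P ℱ 𝕋 ρ Q D t ω :=
  (isFamilyEssSup_discPenaltyStep hρ hQ hD ht).2.1 0
    (zero_mem_lossSetStep hρ (mem_times_of_le t.le_succ ht))

theorem measurable_discPenalty (hρ : IsDynamicConvexRisk P ℱ 𝕋 ρ)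
    (hQ : LocallyAbsolutelyContinuous P Q ℱ 𝕋) (hD : IsDiscounting P Q ℱ 𝕋 D) {t : ℕ}
    (ht : (t : ℕ∞) ∈ 𝕋.times) : Measurable[ℱ t] (discPenalty P ℱ 𝕋 ρ Q D t) :=
  (isFamilyEssSup_discPenalty hρ hQ hD ht).1

theorem measurable_compensator (hρ : IsDynamicConvexRisk P ℱ 𝕋 ρ)
    (hQ : LocallyAbsolutelyContinuous P Q ℱ 𝕋) (hD : IsDiscounting P Q ℱ 𝕋 D) {s t : ℕ}
    (hst : t ≤ s + 1) (ht : (t : ℕ∞) ∈ 𝕋.times) :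
    Measurable[ℱ s] (compensator P ℱ 𝕋 ρ Q D t) := by
  refine Finset.measurable_fun_sum _ fun k hk => ?_
  have hkt := Finset.mem_range.1 hk
  exact (isFamilyEssSup_discPenaltyStep hρ hQ hD (mem_times_of_le hkt ht)).1.mono
    (ℱ.mono (by omega)) le_rfl

theorem ae_compensator_eq (hℱ : ℱ 0 = ⊥) (hρ : IsDynamicConvexRisk P ℱ 𝕋 ρ)
    (hcons : TimeConsistent P ℱ 𝕋 ρ) (hQ : LocallyAbsolutelyContinuous P Q ℱ 𝕋)
    (hD : IsDiscounting P Q ℱ 𝕋 D) (hα : ∀ᵐ ω ∂Q, penalty P ℱ 𝕋 ρ Q D 0 ω < ⊤) {t : ℕ}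
    (ht : (t : ℕ∞) ∈ 𝕋.times) :
    ∀ᵐ ω ∂Q, compensator P ℱ 𝕋 ρ Q D t ω =
      ((∑ k ∈ Finset.range t, (discPenaltyStep P ℱ 𝕋 ρ Q D k ω).toReal : ℝ) : EReal) := by
  induction t with
  | zero => simp [compensator]
  | succ n ih =>
    have hn := mem_times_of_le n.le_succ ht
    obtain ⟨h1, h2⟩ := discPenalty_finite_integrable hℱ hρ hcons hQ hD hα n hn
    filter_upwards [ih hn, (discPenalty_step hρ hcons hQ hD ht h1 h2).1,
      discPenaltyStep_nonneg hρ hQ hD ht] with ω h3 h4 h5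
    rw [Finset.sum_range_succ, EReal.coe_add, ← h3,
      EReal.coe_toReal h4 (ne_bot_of_le_ne_bot EReal.zero_ne_bot h5)]
    exact Finset.sum_range_succ _ _

theorem integrable_riskPart (hρ : IsDynamicConvexRisk P ℱ 𝕋 ρ)
    (hQ : LocallyAbsolutelyContinuous P Q ℱ 𝕋) (hD : IsDiscounting P Q ℱ 𝕋 D)
    {X : RealProcess Ω} (hX : X ∈ Rinfty P ℱ 𝕋) {t : ℕ} (ht : (t : ℕ∞) ∈ 𝕋.times) :
    Integrable (riskPart 𝕋 ρ D X t) Q := by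
  obtain ⟨hrm, C, hC⟩ := risk_mem_Linfty hρ ht hX
  obtain ⟨C', hC0', hC'⟩ := hD.ae_abs_optionalMeasure_mul_le hQ hX
  have hC := hQ.ae_bound_of_Linfty ht hrm hC
  refine Integrable.add ?_ (integrable_finsetSum _ fun s hs => ?_)
  · refine Integrable.of_bound (((hD.stronglyMeasurable ht).mul (hrm.add
      (Rinfty.stronglyMeasurable_coe hX ht))).mono (ℱ.le t)).aestronglyMeasurable (C + C') ?_
    filter_upwards [hC, hC', hD.ae_optionalMeasure] with ω h1 h2 h3
    have h4 := (h3.2 t ht).1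
    rw [norm_mul, Real.norm_of_nonneg h4.1]
    exact (mul_le_of_le_one_left (norm_nonneg _) h4.2).trans
      ((norm_add_le _ _).trans (add_le_add h1 (h2.1 t ht)))
  · have hst : s ≤ t := Nat.lt_succ_iff.1 (Finset.mem_range.1 hs)
    have hs' := mem_times_of_le hst ht
    refine Integrable.of_bound (((hD.stronglyMeasurable hs').mul
      (stronglyMeasurable_increment hX hs').neg).mono (ℱ.le s)).aestronglyMeasurable (C' + C') ?_
    filter_upwards [hC', hD.ae_optionalMeasure] with ω h2 h3
    have h4 := (h3.2 s hs').1
    rw [norm_mul, Real.norm_of_nonneg h4.1, norm_neg]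
    refine (mul_le_of_le_one_left (norm_nonneg _) h4.2).trans ?_
    cases s with
    | zero => exact (h2.1 0 hs').trans (by linarith)
    | succ k =>
      exact (norm_sub_le _ _).trans
        (add_le_add (h2.1 _ hs') (h2.1 k (mem_times_of_le k.le_succ hs')))

/-- Expanding, `X_{t+1}` cancels and `D_{t+1} (ρ_{t+1}(X) + X_t) - D_t (ρ_t(X) + X_t)` remains. The
cash amount `ρ_t(X)`, paid with total mass `D_t`, makes this the loss of an acceptable position. -/
theorem riskPart_succ {X : RealProcess Ω} {t : ℕ} (ht : ((t + 1 : ℕ) : ℕ∞) ∈ 𝕋.times) :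
    riskPart 𝕋 ρ D X (t + 1) = riskPart 𝕋 ρ D X t + -pairingStep 𝕋 D
      (oneStep t (X t + risk 𝕋 ρ t X) (-risk 𝕋 ρ (t + 1) X + risk 𝕋 ρ t X)) t := by
  funext ω
  simp only [riskPart, Pi.add_apply, Pi.neg_apply, pairingStep, oneStep_self,
    oneStep_of_succ_le le_rfl, optionalMeasure_of_succ_mem ht, Finset.sum_range_succ _ (t + 1),
    increment]
  ring

end Martingales

open Horizon in
theorem corollary4p4 {Ω : Type*} {mΩ : MeasurableSpace Ω} (P : Measure Ω) [IsProbabilityMeasure P]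
    (ℱ : Filtration ℕ mΩ) (hℱ : ℱ 0 = ⊥) (𝕋 : Horizon)
    (ρ : ℕ → RealProcess Ω → Ω → ℝ) (hρ : IsDynamicConvexRisk P ℱ 𝕋 ρ)
    (hcons : TimeConsistent P ℱ 𝕋 ρ)
    (hcont : ∀ t : ℕ, (t : ℕ∞) ∈ 𝕋.times → ContinuousFromAbove P ℱ 𝕋 ρ t)
    (Q : Measure Ω) [IsProbabilityMeasure Q] (hQ : LocallyAbsolutelyContinuous P Q ℱ 𝕋)
    (D : RealProcess Ω) (hD : IsDiscounting P Q ℱ 𝕋 D)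
    (hα : ∀ᵐ ω ∂Q, penalty P ℱ 𝕋 ρ Q D 0 ω < ⊤) :
    -- the discounted penalty process is a nonnegative supermartingale
    (∀ t : 𝕋.FiniteTimes, ∀ᵐ ω ∂Q, 0 ≤ discPenalty P ℱ 𝕋 ρ Q D t ω) ∧
    IsSupermartingaleEReal (fun t : 𝕋.FiniteTimes => discPenalty P ℱ 𝕋 ρ Q D t)
      (restrictTimes ℱ 𝕋) Q ∧
    -- its compensator is predictable, starts at zero, is nondecreasing and finite
    (∀ ω, compensator P ℱ 𝕋 ρ Q D 0 ω = 0) ∧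
    (∀ t : ℕ, ((t + 1 : ℕ) : ℕ∞) ∈ 𝕋.times →
      Measurable[ℱ t] (compensator P ℱ 𝕋 ρ Q D (t + 1)) ∧
      ∀ᵐ ω ∂Q, compensator P ℱ 𝕋 ρ Q D t ω ≤ compensator P ℱ 𝕋 ρ Q D (t + 1) ω ∧
        compensator P ℱ 𝕋 ρ Q D (t + 1) ω < ⊤) ∧
    -- adding the compensator yields a martingale
    IsMartingaleEReal (fun (t : 𝕋.FiniteTimes) ω =>
      discPenalty P ℱ 𝕋 ρ Q D t ω + compensator P ℱ 𝕋 ρ Q D t ω) (restrictTimes ℱ 𝕋) Q ∧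
    -- the supermartingale property of the risk process
    ∀ X ∈ Rinfty P ℱ 𝕋,
      IsSupermartingaleEReal (fun t : 𝕋.FiniteTimes => riskProcess P ℱ 𝕋 ρ Q D X t)
        (restrictTimes ℱ 𝕋) Q := by
  have hfi := discPenalty_finite_integrable hℱ hρ hcons hQ hD hα
  have hnn := fun (t : ℕ) (ht : (t : ℕ∞) ∈ 𝕋.times) => discPenalty_nonneg hρ hQ hD ht
  have hbot := fun (t : ℕ) (ht : (t : ℕ∞) ∈ 𝕋.times) =>
    (hnn t ht).mono fun ω h => ne_bot_of_le_ne_bot EReal.zero_ne_bot h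
  have hstep := fun (t : ℕ) (ht : ((t + 1 : ℕ) : ℕ∞) ∈ 𝕋.times) =>
    discPenalty_step hρ hcons hQ hD ht (hfi t (mem_times_of_le t.le_succ ht)).1
      (hfi t (mem_times_of_le t.le_succ ht)).2
  have hcomp := fun (t : ℕ) (ht : (t : ℕ∞) ∈ 𝕋.times) =>
    ae_compensator_eq hℱ hρ hcons hQ hD hα ht
  have hZm := fun (t : ℕ) (ht : (t : ℕ∞) ∈ 𝕋.times) => measurable_discPenalty hρ hQ hD ht
  refine ⟨fun t => hnn t t.2, ⟨fun t => ?_, ?_⟩, fun ω => by simp [compensator],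
    fun t ht => ⟨measurable_compensator hρ hQ hD le_rfl ht, ?_⟩, ⟨fun t => ?_, ?_⟩,
    fun X hX => ?_⟩
  · filter_upwards [(hfi t t.2).1, hbot t t.2] with ω h1 h2 using ⟨h1, h2⟩
  · refine supermartingale_restrictTimes
      (f := fun t ω => (discPenalty P ℱ 𝕋 ρ Q D t ω).toReal)
      (fun t ht => (measurable_ereal_toReal.comp (hZm t ht)).stronglyMeasurable)
      (fun t ht => (hfi t ht).2) fun t ht => ?_
    filter_upwards [(hstep t ht).2.2.2, discPenaltyStep_nonneg hρ hQ hD ht] with ω h1 h2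
    have h3 := EReal.toReal_nonneg h2
    linarith
  · filter_upwards [discPenaltyStep_nonneg hρ hQ hD ht, hcomp (t + 1) ht] with ω h1 h2
    constructor
    · rw [compensator, compensator, Finset.sum_range_succ]
      exact le_add_of_nonneg_right h1
    · rw [h2]
      exact EReal.coe_lt_top _
  · filter_upwards [(hfi t t.2).1, hbot t t.2, hcomp t t.2] with ω h1 h2 h3
    rw [h3, ← EReal.coe_toReal h1 h2, ← EReal.coe_add]
    exact ⟨EReal.coe_ne_top _, EReal.coe_ne_bot _⟩
  · have hVint : ∀ k : ℕ, ((k + 1 : ℕ) : ℕ∞) ∈ 𝕋.times →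
        Integrable (fun ω => (discPenaltyStep P ℱ 𝕋 ρ Q D k ω).toReal) Q := fun k hk =>
      ((hfi k (mem_times_of_le k.le_succ hk)).2.sub integrable_condExp).congr
        (hstep k hk).2.2.2.symm
    let B : ℕ → Ω → ℝ := fun t ω =>
      ∑ k ∈ Finset.range t, (discPenaltyStep P ℱ 𝕋 ρ Q D k ω).toReal
    have hBint : ∀ t : ℕ, (t : ℕ∞) ∈ 𝕋.times → Integrable (B t) Q := fun t ht =>
      integrable_finsetSum _ fun k hk =>
        hVint k (mem_times_of_le (Finset.mem_range.1 hk) ht)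
    have hBm : ∀ t : ℕ, ((t + 1 : ℕ) : ℕ∞) ∈ 𝕋.times → StronglyMeasurable[ℱ t] (B (t + 1)) := by
      intro t ht
      refine Finset.stronglyMeasurable_fun_sum _ fun k hk => ?_
      have hkt : k ≤ t := Nat.lt_succ_iff.1 (Finset.mem_range.1 hk)
      exact ((measurable_ereal_toReal.comp (isFamilyEssSup_discPenaltyStep hρ hQ hD
        (mem_times_of_le (Nat.succ_le_succ hkt) ht)).1).mono (ℱ.mono hkt) le_rfl).stronglyMeasurable
    have heq : ∀ t : ℕ, (t : ℕ∞) ∈ 𝕋.times →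
        (fun ω => (discPenalty P ℱ 𝕋 ρ Q D t ω + compensator P ℱ 𝕋 ρ Q D t ω).toReal) =ᵐ[Q]
          (fun ω => (discPenalty P ℱ 𝕋 ρ Q D t ω).toReal) + B t := fun t ht => by
      filter_upwards [(hfi t ht).1, hbot t ht, hcomp t ht] with ω h1 h2 h3
      rw [h3, EReal.toReal_add h1 h2 (EReal.coe_ne_top _) (EReal.coe_ne_bot _), EReal.toReal_coe,
        Pi.add_apply]
    refine martingale_restrictTimes
      (f := fun t ω => (discPenalty P ℱ 𝕋 ρ Q D t ω + compensator P ℱ 𝕋 ρ Q D t ω).toReal)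
      (fun t ht => (measurable_ereal_toReal.comp ((hZm t ht).add
        (measurable_compensator hρ hQ hD t.le_succ ht))).stronglyMeasurable)
      (fun t ht => ((hfi t ht).2.add (hBint t ht)).congr (heq t ht).symm) fun t ht => ?_
    have ht' := mem_times_of_le t.le_succ ht
    refine (condExp_congr_ae (heq (t + 1) ht)).trans
      ((condExp_add (hfi _ ht).2 (hBint _ ht) _).trans ?_)
    -- Predictability: `B (t + 1)` is known at time `t`, and its last summand is exactly the drift
    -- of the discounted penalty.
    rw [condExp_of_stronglyMeasurable (ℱ.le t) (hBm t ht) (hBint _ ht)]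
    filter_upwards [heq t ht', (hstep t ht).2.2.2] with ω h1 h2
    rw [h1]
    simp only [Pi.add_apply, B, Finset.sum_range_succ _ t, h2]
    ring
  · have heq : ∀ t : ℕ, (t : ℕ∞) ∈ 𝕋.times →
        ∀ᵐ ω ∂Q, riskProcess P ℱ 𝕋 ρ Q D X t ω =
          ((riskPart 𝕋 ρ D X t ω + (discPenalty P ℱ 𝕋 ρ Q D t ω).toReal : ℝ) : EReal) := by
      intro t ht
      filter_upwards [(hfi t ht).1, hbot t ht, (ae_risk_sub_stepFrom hρ hQ hX ht).2]
        with ω h1 h2 h3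
      rw [riskProcess, h3, EReal.coe_add _ (discPenalty P ℱ 𝕋 ρ Q D t ω).toReal,
        EReal.coe_toReal h1 h2, riskPart]
    have heq' : ∀ t : ℕ, (t : ℕ∞) ∈ 𝕋.times →
        (fun ω => (riskProcess P ℱ 𝕋 ρ Q D X t ω).toReal) =ᵐ[Q]
          riskPart 𝕋 ρ D X t + fun ω => (discPenalty P ℱ 𝕋 ρ Q D t ω).toReal := fun t ht => by
      filter_upwards [heq t ht] with ω h
      rw [h, EReal.toReal_coe, Pi.add_apply]
    refine ⟨fun t => ?_, supermartingale_restrictTimes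
      (f := fun t ω => (riskProcess P ℱ 𝕋 ρ Q D X t ω).toReal) (fun t ht => ?_)
      (fun t ht => ((integrable_riskPart hρ hQ hD hX ht).add (hfi t ht).2).congr (heq' t ht).symm)
      fun t ht => ?_⟩
    · filter_upwards [heq t t.2] with ω h
      rw [h]
      exact ⟨EReal.coe_ne_top _, EReal.coe_ne_bot _⟩
    · refine (measurable_ereal_toReal.comp
        (Measurable.add (measurable_coe_real_ereal.comp ?_) (hZm t ht))).stronglyMeasurable
      exact (((hD.stronglyMeasurable ht).mul (ae_risk_sub_stepFrom hρ hQ hX ht).1).add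
        (stronglyMeasurable_sum_increment hD hX ht)).measurable
    · have ht' := mem_times_of_le t.le_succ ht
      have hY := oneStep_mem_acceptanceSetStep hρ hcons ht hX (risk_mem_Linfty hρ ht' hX)
        (Eventually.of_forall fun _ => le_rfl)
      have hYint := (integrable_pairingStep hD hQ (mem_Rinfty_of_mem_acceptanceSetStep ht hY) ht).neg
      have hRint := integrable_riskPart hρ hQ hD hX ht'
      have hV := (isFamilyEssSup_discPenaltyStep hρ hQ hD ht).2.1 _ ⟨_, hY, rfl⟩
      have h1 := heq' (t + 1) ht
      rw [riskPart_succ ht] at h1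
      have h2 := (condExp_congr_ae h1).trans ((condExp_add (hRint.add hYint) (hfi _ ht).2
        (ℱ t)).trans ((condExp_add hRint hYint (ℱ t)).add EventuallyEq.rfl))
      rw [condExp_of_stronglyMeasurable (ℱ.le t) (stronglyMeasurable_riskPart hρ hD hX ht') hRint]
        at h2
      filter_upwards [h2, hV, (hstep t ht).1, (hstep t ht).2.2.2, heq' t ht'] with ω h2 h3 h4 h5 h6
      -- The expected increment of the risk part is at most the one-step penalty, which by `h5` is
      -- the expected decrease of the discounted penalty.
      have h7 := EReal.coe_le_coe_iff.1 (h3.trans (EReal.le_coe_toReal h4))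
      rw [h2, h6]
      simp only [Pi.add_apply]
      linarith
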